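/- Let $H$ be a complex Hilbert space. For a compact operator $A$ on $H$ let $s_1(A)\ge s_2(A)\ge\dots$ be its singular values (the square roots of the eigenvalues of $A^*A$, with multiplicity, continued by zeros if necessary). Let $S_1$ be the class of compact $A$ with $\sum_n s_n(A)<\infty$, let $\mathcal L^{(1,\infty)}$ be the class of compact $A$ with $\sum_{n\le N}s_n(A)=O(\log N)$, and let $\mathcal L^{(1,\infty)}_\omega$ be the class of $A\in\mathcal L^{(1,\infty)}$ for which $\lim_{N\to\infty}\frac1{\log N}\sum_{n\le N}s_n(A)$ exists. Let $\omega$ be a positive bounded linear functional on $\ell^\infty(\mathbb N\setminus\{0\})$ with $\omega(1,1,\dots)=1$, which vanishes on null sequences and satisfies $\omega(a_1,a_2,\dots)=\omega(a_1,a_1,a_2,a_2,\dots)$, and for positive $A\in\mathcal L^{(1,\infty)}$ put $\mathrm{Tr}_\omega(A)=\omega\big(\big(\frac1{\log N}\sum_{n\le N}s_n(A)\big)_N\big)$ (the entry at $N=1$ is immaterial). For $A\in S_1$, $\det(I+A)$ is the product of $1+\mu$ over the eigenvalues $\mu$ of $A$, counted with algebraic multiplicity. Let $T$ be a positive compact operator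 on $H$ with $T\in\mathcal L^{(1,\infty)}$ and $T^p\in S_1$ for all $p>1$. For $p>1$ put $\mathrm{Det}_{p,\omega,T}(\lambda)=\det(I+\lambda T^p)^{p-1}=\exp\big((p-1)\log\det(I+\lambda T^p)\big)$, where $\log\det(I+\lambda T^p)$ is continued continuously along the segment from $0$ to $\lambda$, starting with the value $0$ at $0$. Then: (1) For every $p>1$ the function $\mathrm{Det}_{p,\omega,T}$ is well defined and analytic in a disc $|\lambda|<r$ for some $r>0$, which may depend on $p$. (2) The limit $\mathrm{Det}_{\omega,T}(\lambda):=\lim_{p\to1^+}\mathrm{Det}_{p,\omega,T}(\lambda)$ exists for all $\lambda$ in some disc centred at $0$ if and only if $T\in\mathcal L^{(1,\infty)}_\omega$. (3) If $T\in\mathcal L^{(1,\infty)}_\omega$, then $\mathrm{Det}_{\omega,T}(\lambda)=\exp(\lambda\,\mathrm{Tr}_\omega(T))$ for all $\lambda$ with $|\lambda|$ small enough. In particular $\mathrm{Det}_{\omega,T}'(0)=\mathrm{Tr}_\omega(T)$. Moreover, $\mathrm{Det}_{\omega,T}$, near $0$, has a unique extension to an entire function, so that the regularised determinant $\mathbf{Det}_\omega(I+T)$,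 the value of this extension at $1$, is well defined; it equals $\exp(\mathrm{Tr}_\omega(T))$. -/

import Mathlib

open Filter Topology
open scoped ENNReal

namespace DixmierDet

noncomputable section

variable {H : Type*} [NormedAddCommGroup H] [InnerProductSpace ℂ H] [CompleteSpace H]

/-- The singular values of a compact operator `A`, that is, the square roots of the eigenvalues of
`A* A`, in decreasing order and repeated according to multiplicity; if there are only finitely many
nonzero ones the list is continued by zeros. The index starts at `0`: `singularValue A n` is
`s_{n+1}(A)`, the least `t ≥ 0` such that at most `n` singular values (counted with the dimension
of the eigenspace of `A* A` for the eigenvalue `μ ^ 2`) are larger than `t`. -/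
def singularValue (A : H →L[ℂ] H) (n : ℕ) : ℝ :=
  sInf {t : ℝ | 0 ≤ t ∧
    Module.rank ℂ ↥(⨆ μ ∈ Set.Ioi t, Module.End.eigenspace
      ((ContinuousLinearMap.adjoint A ∘L A : H →L[ℂ] H) : Module.End ℂ H) (((μ : ℝ) ^ 2 : ℝ) : ℂ))
      ≤ (n : Cardinal)}

/-- The trace class `S₁`: compact operators with summable singular values. -/
def IsTraceClass (A : H →L[ℂ] H) : Prop :=
  IsCompactOperator A ∧ Summable (singularValue A)

/-- The sequence `α_N(A) = (s_1(A) + ⋯ + s_N(A)) / log N`, with `N = k + 1` for `k = 0, 1, 2, …`.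
The entry for `N = 1`, where `log N = 0`, has the value `0`; no notion below depends on it. -/
def logMean (A : H →L[ℂ] H) (k : ℕ) : ℝ :=
  (∑ j ∈ Finset.range (k + 1), singularValue A j) / Real.log ((k : ℝ) + 1)

/-- The Dixmier ideal `L^(1,∞)`: compact operators with `s_1(A) + ⋯ + s_N(A) = O(log N)`. -/
def MemDixmierIdeal (A : H →L[ℂ] H) : Prop :=
  IsCompactOperator A ∧
    (fun N : ℕ => ∑ j ∈ Finset.range N, singularValue A j) =O[atTop]
      (fun N : ℕ => Real.log (N : ℝ))

/-- The subclass `L^(1,∞)_ω` of the Dixmier ideal: those `A` for which the limit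
`lim_N (s_1(A) + ⋯ + s_N(A)) / log N` exists (as a real number). -/
def IsDixmierMeasurable (A : H →L[ℂ] H) : Prop :=
  MemDixmierIdeal A ∧ ∃ c : ℝ, Tendsto (logMean A) atTop (𝓝 c)

/-- The functionals `ω` on the bounded sequences `(a_1, a_2, …)` used for Dixmier traces. The entry
`a_n` is stored at the index `n - 1`. -/
structure DixmierFunctional where
  /-- The underlying bounded linear functional on `ℓ^∞`. -/
  toFun : lp (fun _ : ℕ => ℝ) ∞ →L[ℝ] ℝ
  /-- `ω` is positive. -/
  nonneg : ∀ a : lp (fun _ : ℕ => ℝ) ∞, (∀ n, 0 ≤ a n) → 0 ≤ toFun a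
  /-- `ω(1, 1, 1, …) = 1`. -/
  map_one : ∀ a : lp (fun _ : ℕ => ℝ) ∞, (∀ n, a n = 1) → toFun a = 1
  /-- `ω` vanishes on the sequences that tend to `0`. -/
  map_null : ∀ a : lp (fun _ : ℕ => ℝ) ∞, Tendsto (fun n => a n) atTop (𝓝 0) → toFun a = 0
  /-- `ω(a_1, a_2, …) = ω(a_1, a_1, a_2, a_2, …)`. -/
  map_dilate : ∀ a b : lp (fun _ : ℕ => ℝ) ∞, (∀ n, b n = a (n / 2)) → toFun a = toFun b

open Classical in
/-- The Dixmier trace `Tr_ω(A) = ω((α_N(A))_N)` of a positive operator `A` in the Dixmier ideal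
(where the sequence is bounded; elsewhere the value is `0`). -/
def dixmierTrace (ω : DixmierFunctional) (A : H →L[ℂ] H) : ℝ :=
  if h : Memℓp (E := fun _ : ℕ => ℝ) (logMean A) ∞ then
    ω.toFun (⟨logMean A, h⟩ : lp (fun _ : ℕ => ℝ) ∞) else 0

/-- The determinant `det (I + A)` of a trace class operator: the product of `1 + μ` over the
eigenvalues `μ` of `A`, each repeated according to its algebraic multiplicity. (The factor for
`μ = 0`, and for every `μ` that is not an eigenvalue, is `1`.) -/
def detOneAdd (A : H →L[ℂ] H) : ℂ :=
  ∏' μ : ℂ, (1 + μ) ^ Module.finrank ℂ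
    ↥(Module.End.maxGenEigenspace (A : Module.End ℂ H) μ)

/-- `w` is the logarithm of `f z` that is obtained by continuing `log f` along the segment from
`0` to `z`, starting with `log (f 0) = 0`. There is at most one such `w`. -/
def IsLogAlong (f : ℂ → ℂ) (z w : ℂ) : Prop :=
  ∃ l : ℝ → ℂ, ContinuousOn l (Set.Icc 0 1) ∧ l 0 = 0 ∧ l 1 = w ∧
    ∀ t ∈ Set.Icc (0 : ℝ) 1, Complex.exp (l t) = f ((t : ℂ) * z)

open Classical in
/-- The branch of `f z ^ q` with value `1` at `z = 0`, obtained by continuing `log f` along the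
segment from `0` to `z` (and `0` if this is impossible). -/
def powBranch (f : ℂ → ℂ) (q : ℝ) (z : ℂ) : ℂ :=
  if h : ∃ w, IsLogAlong f z w then Complex.exp ((q : ℂ) * h.choose) else 0

/-- `det (I + z T ^ p)` as a function of `z`; `T ^ p` is taken in the functional calculus. -/
def detPow (p : ℝ) (T : H →L[ℂ] H) (z : ℂ) : ℂ :=
  detOneAdd (z • T ^ p)

/-- `Det_{p,ω,T}(z) = det (I + z T ^ p) ^ (p - 1)`, with the branch that is `1` at `z = 0`. -/
def regDetP (p : ℝ) (T : H →L[ℂ] H) : ℂ → ℂ :=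
  powBranch (detPow p T) (p - 1)

/-- `Det_{ω,T}(z) = lim_{p → 1⁺} Det_{p,ω,T}(z)`, for those `z` where the limit exists. -/
def regDetLim (T : H →L[ℂ] H) (z : ℂ) : ℂ :=
  limUnder (𝓝[>] (1 : ℝ)) fun p => regDetP p T z

/-- `d` is a value of the regularised determinant `Det_ω(I + T)`: the value at `1` of an entire
function that agrees with `Det_{ω,T}` near `0`. -/
def IsRegDet (T : H →L[ℂ] H) (d : ℂ) : Prop :=
  ∃ D : ℂ → ℂ, Differentiable ℂ D ∧ D =ᶠ[𝓝 0] regDetLim T ∧ D 1 = d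

end

end DixmierDet

/-!
Write `s n` for the singular values of the positive compact operator `T`; they are its positive
eigenvalues, listed with multiplicity and continued by zeros, so that
`det (I + z T ^ p) = ∏ (1 + z * s n ^ p)`
(`detPow_eq_tprod`). For small `z` this product has the analytic logarithm
`∑ log (1 + z * s n ^ p)` (`logDet`), which is the logarithm continued along the segment from `0`
to `z` because continuous logarithms are unique (`IsLogAlong.unique`). This gives the analyticity.

Since `|log (1 + w) - w| ≤ |w| ^ 2` and `∑ s n ^ (2 * p)` stays bounded as `p → 1⁺`, multiplication
by `p - 1` removes everything but the linear term: `Det_p(z) = exp (z * x p + o(1))` with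
`x p = (p - 1) * ∑ s n ^ p` (`tendsto_regDetP_mul_exp_neg`). Hence the determinants converge near
`0` exactly when `x p` converges; for the direction from determinants to `x p` one positive real
`z` suffices, as there `exp (z * x p) ≥ 1` determines `x p`.

It remains to see that `x p → L` as `p → 1⁺` if and only if `(s 0 + ⋯ + s (N - 1)) / log N → L`.
* The Abelian half (`tendsto_sub_mul_tsum_rpow_of_tendsto_sum_div_log`) is a majorization argument:
  for an antitone `a` whose partial sums are bounded by those of `b` up to a constant, convexity of
  `x ^ p` and summation by parts bound `∑ a n ^ p` by `∑ b n ^ p` up to a constant. Comparison of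
  `s` with `c / (n + 1)` for `c` near `L`, from both sides, reduces the claim to
  `(p - 1) * ζ(p) → 1`.
* The Tauberian half (`tendsto_sum_div_log_of_tendsto_sub_mul_tsum_rpow`) is Karamata's method. The
  hypothesis at the exponents `1 + k * δ` gives the limits of `δ * ∑ s n ^ (1 + δ) * q (s n ^ δ)`
  for polynomials `q`, hence, by Weierstrass approximation, for the function `1 / x` cut off below
  `1 / e`. This is the asymptotics of the sum of the `s n` that are at least `exp (-1 / δ)`, and
  since `s n = O(log n / n)`, cutting off by size and cutting off by index are equivalent on the
  logarithmic scale.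

When the limit `L` exists, every functional `ω` takes the value `L` on the logarithmic means, and
the statements about the derivative and the entire extension follow from the identity theorem.
-/

namespace DixmierDet

/-! ### Majorization and the Abelian theorem -/

/-- Abel's inequality: antitone nonnegative weights preserve an upper bound on partial sums, up to
the factor `w 0`. -/
theorem sum_mul_le_of_antitone {w d : ℕ → ℝ} {K : ℝ} (hw : Antitone w) (hw0 : ∀ n, 0 ≤ w n)
    (hd : ∀ N, ∑ n ∈ Finset.range N, d n ≤ K) (N : ℕ) :
    ∑ n ∈ Finset.range N, w n * d n ≤ w 0 * K := by
  -- Subtracting the boundary term of the summation by parts makes the bound inductive.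
  have key : ∀ N, ∑ n ∈ Finset.range N, w n * d n - w N * ∑ n ∈ Finset.range N, d n
      ≤ (w 0 - w N) * K := by
    intro N
    induction N with
    | zero => simp
    | succ N ih =>
      have h1 := mul_le_mul_of_nonneg_left (hd (N + 1)) (sub_nonneg.2 (hw N.le_succ))
      rw [Finset.sum_range_succ] at h1 ⊢
      rw [Finset.sum_range_succ (fun n => d n)]
      simp only [Nat.succ_eq_add_one] at h1
      linarith
  have h1 := key N
  have h2 := mul_le_mul_of_nonneg_left (hd N) (hw0 N)
  linarith

/-- By convexity, the graph of `x ^ p` lies above its tangent at `a`. -/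
theorem rpow_sub_rpow_le {a b p : ℝ} (ha : 0 ≤ a) (hb : 0 ≤ b) (hp : 1 < p) :
    a ^ p - b ^ p ≤ p * a ^ (p - 1) * (a - b) := by
  rcases ha.eq_or_lt with rfl | ha
  · rw [Real.zero_rpow (by linarith), Real.zero_rpow (by linarith)]
    have := Real.rpow_nonneg hb p
    simp [this]
  · have h1 : -1 ≤ b / a - 1 := by
      have : 0 ≤ b / a := by positivity
      linarith
    have h2 := one_add_mul_self_le_rpow_one_add h1 hp.le
    rw [add_sub_cancel, Real.div_rpow hb ha.le, le_div_iff₀ (by positivity)] at h2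
    have h3 : a ^ p = a ^ (p - 1) * a := by
      rw [← Real.rpow_add_one ha.ne']; ring_nf
    have h4 : (1 + p * (b / a - 1)) * a ^ p = a ^ p + p * a ^ (p - 1) * (b - a) := by
      rw [h3]; field_simp
    linarith

/-- Majorization: only the dominated sequence `a` has to be antitone, because the weights
`p * a n ^ (p - 1)` in the tangent inequality come from `a`. -/
theorem sum_rpow_le_of_sum_le {a b : ℕ → ℝ} {K p : ℝ} (ha : Antitone a) (ha0 : ∀ n, 0 ≤ a n)
    (hb0 : ∀ n, 0 ≤ b n) (hp : 1 < p)
    (h : ∀ N, ∑ n ∈ Finset.range N, a n ≤ K + ∑ n ∈ Finset.range N, b n) (N : ℕ) :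
    ∑ n ∈ Finset.range N, a n ^ p ≤ p * a 0 ^ (p - 1) * K + ∑ n ∈ Finset.range N, b n ^ p := by
  have h1 := sum_mul_le_of_antitone (w := fun n => p * a n ^ (p - 1)) (d := fun n => a n - b n)
    (K := K)
    (fun m n hmn => mul_le_mul_of_nonneg_left
      (Real.rpow_le_rpow (ha0 n) (ha hmn) (by linarith)) (by linarith))
    (fun n => mul_nonneg (by linarith) (Real.rpow_nonneg (ha0 n) _))
    (fun N => by rw [Finset.sum_sub_distrib]; linarith [h N]) N
  have h2 : ∑ n ∈ Finset.range N, a n ^ p - ∑ n ∈ Finset.range N, b n ^ p ≤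
      ∑ n ∈ Finset.range N, p * a n ^ (p - 1) * (a n - b n) := by
    rw [← Finset.sum_sub_distrib]
    exact Finset.sum_le_sum fun n _ => rpow_sub_rpow_le (ha0 n) (hb0 n) hp
  linarith

theorem summable_div_add_one_rpow {c p : ℝ} (hc : 0 ≤ c) (hp : 1 < p) :
    Summable fun n : ℕ => (c / ((n : ℝ) + 1)) ^ p := by
  have h : Summable fun n : ℕ => 1 / ((n : ℝ)) ^ p := Real.summable_one_div_nat_rpow.2 hp
  have h1 := ((summable_nat_add_iff 1).2 h).mul_left (c ^ p)
  refine h1.congr fun n => ?_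
  rw [Real.div_rpow hc (by positivity)]
  push_cast
  ring

/-- The model case `s n = c / (n + 1)`, which is the simple pole of the zeta function at `1`. -/
theorem tendsto_sub_mul_tsum_div_add_one_rpow {c : ℝ} (hc : 0 ≤ c) :
    Tendsto (fun p : ℝ => (p - 1) * ∑' n : ℕ, (c / ((n : ℝ) + 1)) ^ p) (𝓝[>] 1) (𝓝 c) := by
  have h1 : Tendsto (fun p : ℝ => c ^ p) (𝓝[>] 1) (𝓝 c) := by
    have : Tendsto (fun p : ℝ => c ^ p) (𝓝 1) (𝓝 (c ^ (1 : ℝ))) :=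
      tendsto_const_nhds.rpow tendsto_id (Or.inr one_pos)
    rw [Real.rpow_one] at this
    exact this.mono_left nhdsWithin_le_nhds
  have h2 := h1.mul tendsto_sub_mul_tsum_nat_rpow
  rw [mul_one] at h2
  refine h2.congr' ?_
  filter_upwards [self_mem_nhdsWithin] with p (hp : 1 < p)
  have h : Summable fun n : ℕ => 1 / ((n : ℝ)) ^ p := Real.summable_one_div_nat_rpow.2 hp
  rw [h.tsum_eq_zero_add, mul_left_comm]
  simp only [Nat.cast_zero, Real.zero_rpow (show p ≠ 0 by linarith), div_zero, zero_add]
  rw [← tsum_mul_left]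
  congr 1
  refine tsum_congr fun n => ?_
  rw [Real.div_rpow hc (by positivity)]
  push_cast
  ring

theorem log_le_sum_inv (N : ℕ) :
    Real.log N ≤ ∑ n ∈ Finset.range N, 1 / ((n : ℝ) + 1) := by
  have h := log_add_one_le_harmonic N
  have h2 : ((harmonic N : ℚ) : ℝ) = ∑ n ∈ Finset.range N, 1 / ((n : ℝ) + 1) := by
    simp [harmonic]
  rw [← h2]
  refine le_trans ?_ h
  rcases N.eq_zero_or_pos with rfl | hN
  · simp
  · exact Real.log_le_log (by exact_mod_cast hN) (by push_cast; linarith)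

theorem sum_inv_le_one_add_log (N : ℕ) :
    ∑ n ∈ Finset.range N, 1 / ((n : ℝ) + 1) ≤ 1 + Real.log N := by
  have h := harmonic_le_one_add_log N
  have h2 : ((harmonic N : ℚ) : ℝ) = ∑ n ∈ Finset.range N, 1 / ((n : ℝ) + 1) := by
    simp [harmonic]
  rwa [h2] at h

/-- A bound on partial sums that holds eventually holds always after enlarging the constant. -/
theorem exists_sum_le_add_sum {a b : ℕ → ℝ} (ha0 : ∀ n, 0 ≤ a n) (hb0 : ∀ n, 0 ≤ b n) {K : ℝ}
    (h : ∀ᶠ N in atTop, ∑ n ∈ Finset.range N, a n ≤ K + ∑ n ∈ Finset.range N, b n) :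
    ∃ K', ∀ N, ∑ n ∈ Finset.range N, a n ≤ K' + ∑ n ∈ Finset.range N, b n := by
  obtain ⟨N₀, h⟩ := eventually_atTop.1 h
  refine ⟨max K (∑ n ∈ Finset.range N₀, a n), fun N => ?_⟩
  rcases le_total N₀ N with hN | hN
  · have := h N hN
    linarith [le_max_left K (∑ n ∈ Finset.range N₀, a n)]
  · have h1 : ∑ n ∈ Finset.range N, a n ≤ ∑ n ∈ Finset.range N₀, a n :=
      Finset.sum_le_sum_of_subset_of_nonneg (Finset.range_mono hN) fun n _ _ => ha0 n
    have h2 : 0 ≤ ∑ n ∈ Finset.range N, b n := Finset.sum_nonneg fun n _ => hb0 n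
    linarith [le_max_right K (∑ n ∈ Finset.range N₀, a n)]

theorem summable_rpow_of_sum_isBigO_log {s : ℕ → ℝ} (hs : Antitone s) (hs0 : ∀ n, 0 ≤ s n)
    (hO : (fun N : ℕ => ∑ n ∈ Finset.range N, s n) =O[atTop] fun N : ℕ => Real.log (N : ℝ))
    {p : ℝ} (hp : 1 < p) : Summable fun n => s n ^ p := by
  obtain ⟨C, hC, h⟩ := hO.exists_nonneg
  have hb0 : ∀ n : ℕ, 0 ≤ C / ((n : ℝ) + 1) := fun n => by positivity
  have h1 : ∀ᶠ N : ℕ in atTop, ∑ n ∈ Finset.range N, s n ≤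
      0 + ∑ n ∈ Finset.range N, C / ((n : ℝ) + 1) := by
    filter_upwards [h.bound, eventually_ge_atTop 1] with N hN hN1
    rw [Real.norm_of_nonneg (Real.log_nonneg (by exact_mod_cast hN1))] at hN
    have h2 := mul_le_mul_of_nonneg_left (log_le_sum_inv N) hC
    rw [Finset.mul_sum] at h2
    simp only [mul_one_div] at h2
    linarith [Real.le_norm_self (∑ n ∈ Finset.range N, s n)]
  obtain ⟨K, hK⟩ := exists_sum_le_add_sum hs0 hb0 h1
  refine summable_of_sum_range_le (fun n => Real.rpow_nonneg (hs0 n) p) fun N =>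
    (sum_rpow_le_of_sum_le hs hs0 hb0 hp hK N).trans
      (add_le_add_right ((summable_div_add_one_rpow hC hp).sum_le_tsum _
        fun n _ => Real.rpow_nonneg (hb0 n) p) _)

/-- The error term is stated with `1 + a 0` in place of `a 0`, so that it is continuous in `p` at
`1` even if `a 0 = 0`. -/
theorem tsum_rpow_le_of_sum_le {a b : ℕ → ℝ} {K p : ℝ} (ha : Antitone a) (ha0 : ∀ n, 0 ≤ a n)
    (hb0 : ∀ n, 0 ≤ b n) (hp : 1 < p) (hb : Summable fun n => b n ^ p) (hK : 0 ≤ K)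
    (h : ∀ N, ∑ n ∈ Finset.range N, a n ≤ K + ∑ n ∈ Finset.range N, b n) :
    ∑' n, a n ^ p ≤ p * (1 + a 0) ^ (p - 1) * K + ∑' n, b n ^ p := by
  refine Real.tsum_le_of_sum_range_le (fun n => Real.rpow_nonneg (ha0 n) p) fun N =>
    (sum_rpow_le_of_sum_le ha ha0 hb0 hp h N).trans (add_le_add ?_ (hb.sum_le_tsum _
        fun n _ => Real.rpow_nonneg (hb0 n) p))
  gcongr
  · exact ha0 0
  · linarith

theorem tendsto_sub_mul_rpow_mul {c K : ℝ} (hc : 0 ≤ c) :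
    Tendsto (fun p : ℝ => (p - 1) * (p * (1 + c) ^ (p - 1) * K)) (𝓝[>] 1) (𝓝 0) := by
  have h : Tendsto (fun p : ℝ => (p - 1) * (p * (1 + c) ^ (p - 1) * K)) (𝓝 1)
      (𝓝 ((1 - 1) * (1 * (1 + c) ^ ((1 : ℝ) - 1) * K))) := by
    have h1 : Tendsto (fun p : ℝ => p - 1) (𝓝 1) (𝓝 (1 - 1)) := tendsto_id.sub tendsto_const_nhds
    refine h1.mul ((tendsto_id.mul ?_).mul tendsto_const_nhds)
    exact tendsto_const_nhds.rpow h1 (Or.inl (by linarith))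
  rw [sub_self, zero_mul] at h
  exact h.mono_left nhdsWithin_le_nhds

/-- The Abelian theorem: logarithmic means determine the residue of `∑ s n ^ p` at `p = 1`. -/
theorem tendsto_sub_mul_tsum_rpow_of_tendsto_sum_div_log {s : ℕ → ℝ} (hs : Antitone s)
    (hs0 : ∀ n, 0 ≤ s n) (hsum : ∀ p : ℝ, 1 < p → Summable fun n => s n ^ p) {L : ℝ}
    (h : Tendsto (fun N : ℕ => (∑ n ∈ Finset.range N, s n) / Real.log N) atTop (𝓝 L)) :
    Tendsto (fun p : ℝ => (p - 1) * ∑' n, s n ^ p) (𝓝[>] 1) (𝓝 L) := by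
  have hlog : ∀ᶠ N : ℕ in atTop, 0 < Real.log N := by
    filter_upwards [eventually_ge_atTop 2] with N hN
    exact Real.log_pos (by exact_mod_cast hN)
  have hL : 0 ≤ L := by
    refine ge_of_tendsto h ?_
    filter_upwards [hlog] with N hN
    exact div_nonneg (Finset.sum_nonneg fun n _ => hs0 n) hN.le
  refine tendsto_order.2 ⟨fun a ha => ?_, fun a ha => ?_⟩
  · rcases lt_or_ge a 0 with ha0 | ha0
    · filter_upwards [self_mem_nhdsWithin] with p (hp : 1 < p)
      exact ha0.trans_le (mul_nonneg (by linarith)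
        (tsum_nonneg fun n => Real.rpow_nonneg (hs0 n) p))
    -- Here `c / (n + 1)` is the dominated sequence, for a `c` strictly between `a` and `L`.
    set c := (a + L) / 2 with hc
    have hc0 : 0 ≤ c := by linarith
    have hb0 : ∀ n : ℕ, 0 ≤ c / ((n : ℝ) + 1) := fun n => by positivity
    have h1 : ∀ᶠ N : ℕ in atTop, ∑ n ∈ Finset.range N, c / ((n : ℝ) + 1) ≤
        c + ∑ n ∈ Finset.range N, s n := by
      filter_upwards [hlog, (tendsto_order.1 h).1 c (by linarith)] with N hN hN2
      rw [lt_div_iff₀ hN] at hN2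
      have h2 := mul_le_mul_of_nonneg_left (sum_inv_le_one_add_log N) hc0
      rw [Finset.mul_sum] at h2
      simp only [mul_one_div] at h2
      linarith
    obtain ⟨K, hK⟩ := exists_sum_le_add_sum hb0 hs0 h1
    have hK0 : 0 ≤ K := by simpa using hK 0
    have hanti : Antitone fun n : ℕ => c / ((n : ℝ) + 1) := fun m n hmn => by
      dsimp only
      gcongr
    have h3 := (tendsto_sub_mul_tsum_div_add_one_rpow hc0).sub
      (tendsto_sub_mul_rpow_mul (K := K) (hb0 0))
    rw [sub_zero] at h3
    filter_upwards [self_mem_nhdsWithin, (tendsto_order.1 h3).1 a (by linarith)] with p hp hp2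
    have h4 := tsum_rpow_le_of_sum_le hanti hb0 hs0 hp (hsum p hp) hK0 hK
    have h5 := mul_le_mul_of_nonneg_left h4 (sub_nonneg.2 (le_of_lt hp))
    rw [mul_add] at h5
    linarith
  · -- Here `s` is the dominated sequence, for a `c` strictly between `L` and `a`.
    set c := (a + L) / 2 with hc
    have hc0 : 0 ≤ c := by linarith
    have hb0 : ∀ n : ℕ, 0 ≤ c / ((n : ℝ) + 1) := fun n => by positivity
    have h1 : ∀ᶠ N : ℕ in atTop, ∑ n ∈ Finset.range N, s n ≤
        0 + ∑ n ∈ Finset.range N, c / ((n : ℝ) + 1) := by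
      filter_upwards [hlog, (tendsto_order.1 h).2 c (by linarith)] with N hN hN2
      rw [div_lt_iff₀ hN] at hN2
      have h2 := mul_le_mul_of_nonneg_left (log_le_sum_inv N) hc0
      rw [Finset.mul_sum] at h2
      simp only [mul_one_div] at h2
      linarith
    obtain ⟨K, hK⟩ := exists_sum_le_add_sum hs0 hb0 h1
    have hK0 : 0 ≤ K := by simpa using hK 0
    have h3 := (tendsto_sub_mul_tsum_div_add_one_rpow hc0).add
      (tendsto_sub_mul_rpow_mul (K := K) (hs0 0))
    rw [add_zero] at h3
    filter_upwards [self_mem_nhdsWithin, (tendsto_order.1 h3).2 a (by linarith)] with p hp hp2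
    have h4 := tsum_rpow_le_of_sum_le hs hs0 hb0 hp (summable_div_add_one_rpow hc0 hp) hK0 hK
    have h5 := mul_le_mul_of_nonneg_left h4 (sub_nonneg.2 (le_of_lt hp))
    rw [mul_add] at h5
    linarith

/-! ### Karamata's Tauberian theorem -/

/-- The averages `δ ∑ sₙ^(1+δ) q(sₙ^δ)` of a test function `q` on `[0, 1]`. -/
noncomputable def powerAverage (s : ℕ → ℝ) (q : ℝ → ℝ) (δ : ℝ) : ℝ :=
  δ * ∑' n, s n ^ (1 + δ) * q (s n ^ δ)

theorem rpow_mem_unitInterval {x δ : ℝ} (h0 : 0 ≤ x) (h1 : x ≤ 1) (hδ : 0 < δ) :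
    x ^ δ ∈ Set.Icc (0 : ℝ) 1 :=
  ⟨Real.rpow_nonneg h0 δ, Real.rpow_le_one h0 h1 hδ.le⟩

theorem summable_powerAverage {s : ℕ → ℝ} (hs0 : ∀ n, 0 ≤ s n) (hs1 : ∀ n, s n ≤ 1)
    (hsum : ∀ p : ℝ, 1 < p → Summable fun n => s n ^ p) {q : ℝ → ℝ} {B : ℝ}
    (hq : ∀ x ∈ Set.Icc (0 : ℝ) 1, |q x| ≤ B) {δ : ℝ} (hδ : 0 < δ) :
    Summable fun n => s n ^ (1 + δ) * q (s n ^ δ) := by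
  refine ((hsum (1 + δ) (by linarith)).mul_right B).of_norm_bounded fun n => ?_
  rw [norm_mul, Real.norm_of_nonneg (Real.rpow_nonneg (hs0 n) _)]
  exact mul_le_mul_of_nonneg_left (hq _ (rpow_mem_unitInterval (hs0 n) (hs1 n) hδ))
    (Real.rpow_nonneg (hs0 n) _)

theorem exists_abs_le_of_continuousOn {q : ℝ → ℝ} (hq : ContinuousOn q (Set.Icc 0 1)) :
    ∃ B, ∀ x ∈ Set.Icc (0 : ℝ) 1, |q x| ≤ B :=
  isCompact_Icc.exists_bound_of_continuousOn hq

/-- For the monomial `x ^ k` the average is, up to the factor `1 / (k + 1) = ∫ x ^ k`, the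
hypothesis at the exponent `1 + (k + 1) * δ`. -/
theorem tendsto_powerAverage_polynomial {s : ℕ → ℝ} (hs0 : ∀ n, 0 ≤ s n) (hs1 : ∀ n, s n ≤ 1)
    (hsum : ∀ p : ℝ, 1 < p → Summable fun n => s n ^ p) {L : ℝ}
    (h : Tendsto (fun p : ℝ => (p - 1) * ∑' n, s n ^ p) (𝓝[>] 1) (𝓝 L)) (P : Polynomial ℝ) :
    Tendsto (powerAverage s fun x => P.eval x) (𝓝[>] 0) (𝓝 (L * ∫ x in (0 : ℝ)..1, P.eval x)) := by
  induction P using Polynomial.induction_on' with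
  | add P Q hP hQ =>
    have hi : ∀ P : Polynomial ℝ, IntervalIntegrable (fun x => P.eval x) MeasureTheory.volume 0 1 :=
      fun P => P.continuous.intervalIntegrable _ _
    simp only [Polynomial.eval_add]
    rw [intervalIntegral.integral_add (hi P) (hi Q), mul_add]
    refine (hP.add hQ).congr' ?_
    filter_upwards [self_mem_nhdsWithin] with δ (hδ : 0 < δ)
    have hsm : ∀ P : Polynomial ℝ, Summable fun n => s n ^ (1 + δ) * P.eval (s n ^ δ) := fun P => by
      obtain ⟨B, hB⟩ := exists_abs_le_of_continuousOn P.continuous.continuousOn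
      exact summable_powerAverage hs0 hs1 hsum hB hδ
    simp only [powerAverage, mul_add]
    rw [(hsm P).tsum_add (hsm Q), mul_add]
  | monomial k a =>
    have h1 : ∫ x in (0 : ℝ)..1, (Polynomial.monomial k a).eval x = a / (k + 1) := by
      simp [div_eq_mul_inv]
    rw [h1]
    have h2 : Tendsto (fun δ : ℝ => 1 + (k + 1) * δ) (𝓝[>] 0) (𝓝[>] 1) := by
      refine tendsto_nhdsWithin_iff.2 ⟨?_, ?_⟩
      · have : Tendsto (fun δ : ℝ => 1 + (k + 1) * δ) (𝓝 0) (𝓝 (1 + (k + 1) * 0)) := by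
          apply Continuous.tendsto; fun_prop
        rw [mul_zero, add_zero] at this
        exact this.mono_left nhdsWithin_le_nhds
      · filter_upwards [self_mem_nhdsWithin] with δ (hδ : 0 < δ)
        have : 0 < ((k : ℝ) + 1) * δ := by positivity
        simpa using this
    have h3 := (h.comp h2).const_mul (a / (k + 1))
    rw [mul_comm L]
    refine h3.congr' ?_
    filter_upwards [self_mem_nhdsWithin] with δ (hδ : 0 < δ)
    have h4 : ∀ n, s n ^ (1 + δ) * (Polynomial.monomial k a).eval (s n ^ δ) =
        s n ^ (1 + (k + 1) * δ) * a := fun n => by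
      rw [Polynomial.eval_monomial, mul_left_comm, ← Real.rpow_natCast, ← Real.rpow_mul (hs0 n),
        ← Real.rpow_add_of_nonneg (hs0 n) (by positivity) (by positivity), mul_comm a]
      ring_nf
    simp only [powerAverage, h4, Function.comp_apply, tsum_mul_right]
    field_simp
    ring

/-- A test function below a continuous one has averages that are asymptotically at most `L` times
the integral of the latter. -/
theorem eventually_powerAverage_lt {s : ℕ → ℝ} (hs0 : ∀ n, 0 ≤ s n) (hs1 : ∀ n, s n ≤ 1)
    (hsum : ∀ p : ℝ, 1 < p → Summable fun n => s n ^ p) {L : ℝ}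
    (h : Tendsto (fun p : ℝ => (p - 1) * ∑' n, s n ^ p) (𝓝[>] 1) (𝓝 L)) {f g : ℝ → ℝ} {B a : ℝ}
    (hf : ∀ x ∈ Set.Icc (0 : ℝ) 1, |f x| ≤ B) (hg : ContinuousOn g (Set.Icc 0 1))
    (hfg : ∀ x ∈ Set.Icc (0 : ℝ) 1, f x ≤ g x) (ha : L * ∫ x in (0 : ℝ)..1, g x < a) :
    ∀ᶠ δ in 𝓝[>] (0 : ℝ), powerAverage s f δ < a := by
  have hL : 0 ≤ L := by
    refine ge_of_tendsto h ?_
    filter_upwards [self_mem_nhdsWithin] with p (hp : 1 < p)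
    exact mul_nonneg (by linarith) (tsum_nonneg fun n => Real.rpow_nonneg (hs0 n) p)
  obtain ⟨ε, hε, hεa⟩ : ∃ ε > 0, L * ((∫ x in (0 : ℝ)..1, g x) + 2 * ε) < a := by
    refine ⟨(a - L * ∫ x in (0 : ℝ)..1, g x) / (2 * (L + 1)), div_pos (by linarith)
      (by linarith), ?_⟩
    set I := ∫ x in (0 : ℝ)..1, g x
    have h1 : L * (I + 2 * ((a - L * I) / (2 * (L + 1)))) = L * I + L / (L + 1) * (a - L * I) := by
      field_simp
    have h2 : L / (L + 1) < 1 := by rw [div_lt_one (by linarith)]; linarith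
    nlinarith
  obtain ⟨P, hP⟩ := exists_polynomial_near_of_continuousOn 0 1 g hg ε hε
  set Q : Polynomial ℝ := P + Polynomial.C ε with hQ
  have hQg : ∀ x ∈ Set.Icc (0 : ℝ) 1, g x ≤ Q.eval x ∧ Q.eval x ≤ g x + 2 * ε := fun x hx => by
    have := abs_lt.1 (hP x hx)
    simp only [hQ, Polynomial.eval_add, Polynomial.eval_C]
    constructor <;> linarith
  have hgi : IntervalIntegrable g MeasureTheory.volume 0 1 :=
    ContinuousOn.intervalIntegrable (by rwa [Set.uIcc_of_le zero_le_one])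
  have hQI : ∫ x in (0 : ℝ)..1, Q.eval x ≤ (∫ x in (0 : ℝ)..1, g x) + 2 * ε := by
    have h1 : ∫ x in (0 : ℝ)..1, Q.eval x ≤ ∫ x in (0 : ℝ)..1, (g x + 2 * ε) :=
      intervalIntegral.integral_mono_on zero_le_one (Q.continuous.intervalIntegrable _ _)
        (hgi.add intervalIntegrable_const) fun x hx => (hQg x hx).2
    rw [intervalIntegral.integral_add hgi intervalIntegrable_const] at h1
    simpa using h1
  have h2 := tendsto_powerAverage_polynomial hs0 hs1 hsum h Q
  obtain ⟨B', hB'⟩ := exists_abs_le_of_continuousOn Q.continuous.continuousOn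
  filter_upwards [self_mem_nhdsWithin, (tendsto_order.1 h2).2 a
    ((mul_le_mul_of_nonneg_left hQI hL).trans_lt hεa)] with δ (hδ : 0 < δ) hδa
  refine lt_of_le_of_lt ?_ hδa
  refine mul_le_mul_of_nonneg_left (Summable.tsum_le_tsum (fun n => ?_)
    (summable_powerAverage hs0 hs1 hsum hf hδ) (summable_powerAverage hs0 hs1 hsum hB' hδ)) hδ.le
  have hx := rpow_mem_unitInterval (hs0 n) (hs1 n) hδ
  exact mul_le_mul_of_nonneg_left ((hfg _ hx).trans (hQg _ hx).1) (Real.rpow_nonneg (hs0 n) _)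

/-- Karamata's test function: `1 / x` on `[e⁻¹, 1]` and `0` below `e⁻¹`. -/
noncomputable def karamataFun (x : ℝ) : ℝ := if Real.exp (-1) ≤ x then 1 / x else 0

/-- Continuous approximations of `karamataFun`: from above for `b = 1`, from below for `b = 0`. -/
noncomputable def karamataRamp (b : ℝ) (k : ℕ) (x : ℝ) : ℝ :=
  max 0 (min 1 (b + k * (x - Real.exp (-1)))) * (1 / max x (Real.exp (-1)))

theorem continuous_karamataRamp (b : ℝ) (k : ℕ) : Continuous (karamataRamp b k) := by
  unfold karamataRamp
  refine Continuous.mul (by fun_prop) (continuous_const.div (by fun_prop) fun x => ?_)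
  exact ((Real.exp_pos _).trans_le (le_max_right _ _)).ne'

theorem abs_karamataRamp_le (b : ℝ) (k : ℕ) (x : ℝ) : |karamataRamp b k x| ≤ Real.exp 1 := by
  have h0 := Real.exp_pos (-1)
  have h1 : 0 < max x (Real.exp (-1)) := h0.trans_le (le_max_right _ _)
  have h2 : 1 / max x (Real.exp (-1)) ≤ Real.exp 1 := by
    rw [div_le_iff₀ h1]
    calc (1 : ℝ) = Real.exp 1 * Real.exp (-1) := by rw [← Real.exp_add]; simp
      _ ≤ _ := by gcongr; exact le_max_right _ _
  have h3 : max 0 (min 1 (b + k * (x - Real.exp (-1)))) ≤ 1 :=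
    max_le zero_le_one (min_le_left _ _)
  rw [karamataRamp, abs_of_nonneg (by positivity)]
  calc _ ≤ 1 * (1 / max x (Real.exp (-1))) := by gcongr
    _ ≤ _ := by rwa [one_mul]

theorem karamataFun_le_ramp (k : ℕ) (x : ℝ) : karamataFun x ≤ karamataRamp 1 k x := by
  have h0 := Real.exp_pos (-1)
  have h1 : 0 < max x (Real.exp (-1)) := h0.trans_le (le_max_right _ _)
  rw [karamataFun]
  split_ifs with h
  · have h2 : 0 ≤ k * (x - Real.exp (-1)) := mul_nonneg (by positivity) (by linarith)
    rw [karamataRamp, max_eq_left h, min_eq_left (by linarith), max_eq_right zero_le_one, one_mul]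
  · rw [karamataRamp]; positivity

theorem ramp_le_karamataFun (k : ℕ) (x : ℝ) : karamataRamp 0 k x ≤ karamataFun x := by
  have h0 := Real.exp_pos (-1)
  rw [karamataFun]
  split_ifs with h
  · rw [karamataRamp, max_eq_left h]
    have hx : 0 < x := h0.trans_le h
    calc _ ≤ 1 * (1 / x) := by
          gcongr
          exact max_le zero_le_one (min_le_left _ _)
      _ = _ := one_mul _
  · have h2 : k * (x - Real.exp (-1)) ≤ 0 :=
      mul_nonpos_of_nonneg_of_nonpos (by positivity) (by linarith)
    rw [karamataRamp, max_eq_left ((min_le_right _ _).trans (by linarith)), zero_mul]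

theorem integral_karamataFun : ∫ x in (0 : ℝ)..1, karamataFun x = 1 := by
  have h0 := Real.exp_pos (-1)
  have h1 : Real.exp (-1) ≤ 1 := Real.exp_le_one_iff.2 (by norm_num)
  have e1 : Set.EqOn (fun _ => (0 : ℝ)) karamataFun (Set.uIoo 0 (Real.exp (-1))) := fun x hx => by
    rw [Set.uIoo_of_le h0.le] at hx
    simp [karamataFun, hx.2]
  have e2 : Set.EqOn (fun x => 1 / x) karamataFun (Set.uIoo (Real.exp (-1)) 1) := fun x hx => by
    rw [Set.uIoo_of_le h1] at hx
    simp [karamataFun, hx.1.le]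
  have i2 : IntervalIntegrable (fun x : ℝ => 1 / x) MeasureTheory.volume (Real.exp (-1)) 1 := by
    refine ContinuousOn.intervalIntegrable fun x hx => ?_
    rw [Set.uIcc_of_le h1] at hx
    exact (continuousAt_const.div continuousAt_id (h0.trans_le hx.1).ne').continuousWithinAt
  rw [← intervalIntegral.integral_add_adjacent_intervals
    ((intervalIntegrable_const (μ := MeasureTheory.volume) (c := (0 : ℝ))).congr_uIoo e1)
    (i2.congr_uIoo e2),
    ← intervalIntegral.integral_congr_uIoo e1, ← intervalIntegral.integral_congr_uIoo e2,
    integral_one_div_of_pos h0 one_pos]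
  simp

theorem tendsto_integral_karamataRamp (b : ℝ) :
    Tendsto (fun k => ∫ x in (0 : ℝ)..1, karamataRamp b k x) atTop (𝓝 1) := by
  have h0 := Real.exp_pos (-1)
  rw [show 𝓝 (1 : ℝ) = 𝓝 (∫ x in (0 : ℝ)..1, karamataFun x) by rw [integral_karamataFun]]
  refine intervalIntegral.tendsto_integral_filter_of_dominated_convergence (fun _ => Real.exp 1)
    (.of_forall fun k => (continuous_karamataRamp b k).aestronglyMeasurable)
    (.of_forall fun k => .of_forall fun x _ => abs_karamataRamp_le b k x)
    intervalIntegrable_const ?_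
  filter_upwards [MeasureTheory.Measure.ae_ne MeasureTheory.volume (Real.exp (-1))] with x hx _
  refine tendsto_const_nhds.congr' ?_
  rcases lt_or_gt_of_ne hx with hx | hx
  · have h1 : Tendsto (fun k : ℕ => b + k * (x - Real.exp (-1))) atTop atBot :=
      tendsto_atBot_add_const_left _ _
        (tendsto_natCast_atTop_atTop.atTop_mul_const_of_neg (by linarith))
    filter_upwards [h1.eventually_le_atBot 0] with k hk
    rw [karamataFun, if_neg (by linarith), karamataRamp,
      max_eq_left ((min_le_right _ _).trans hk), zero_mul]
  · have h1 : Tendsto (fun k : ℕ => b + k * (x - Real.exp (-1))) atTop atTop :=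
      tendsto_atTop_add_const_left _ _
        (tendsto_natCast_atTop_atTop.atTop_mul_const (by linarith))
    filter_upwards [h1.eventually_ge_atTop 1] with k hk
    rw [karamataFun, if_pos hx.le, karamataRamp, min_eq_left hk, max_eq_right zero_le_one,
      max_eq_left hx.le, one_mul]

theorem abs_karamataFun_le (x : ℝ) : |karamataFun x| ≤ Real.exp 1 := by
  have h0 := Real.exp_pos (-1)
  have h1 : 0 ≤ karamataFun x := by
    rw [karamataFun]; split_ifs with h
    · exact one_div_nonneg.2 (h0.le.trans h)
    · exact le_rfl
  rw [abs_of_nonneg h1]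
  exact (karamataFun_le_ramp 0 x).trans ((le_abs_self _).trans (abs_karamataRamp_le 1 0 x))

theorem tendsto_powerAverage_karamataFun {s : ℕ → ℝ} (hs0 : ∀ n, 0 ≤ s n) (hs1 : ∀ n, s n ≤ 1)
    (hsum : ∀ p : ℝ, 1 < p → Summable fun n => s n ^ p) {L : ℝ}
    (h : Tendsto (fun p : ℝ => (p - 1) * ∑' n, s n ^ p) (𝓝[>] 1) (𝓝 L)) :
    Tendsto (powerAverage s karamataFun) (𝓝[>] 0) (𝓝 L) := by
  refine tendsto_order.2 ⟨fun a ha => ?_, fun a ha => ?_⟩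
  · have h1 := (tendsto_integral_karamataRamp 0).const_mul L
    rw [mul_one] at h1
    obtain ⟨k, hk⟩ := ((tendsto_order.1 h1).1 a ha).exists
    have h2 := eventually_powerAverage_lt hs0 hs1 hsum h (f := fun x => -karamataFun x)
      (g := fun x => -karamataRamp 0 k x) (B := Real.exp 1) (a := -a)
      (fun x _ => by rw [abs_neg]; exact abs_karamataFun_le x)
      (continuous_karamataRamp 0 k).neg.continuousOn
      (fun x _ => neg_le_neg (ramp_le_karamataFun k x))
      (by rw [intervalIntegral.integral_neg]; linarith)
    filter_upwards [h2] with δ hδ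
    simp only [powerAverage, mul_neg, tsum_neg] at hδ
    exact neg_lt_neg_iff.1 hδ
  · have h1 := (tendsto_integral_karamataRamp 1).const_mul L
    rw [mul_one] at h1
    obtain ⟨k, hk⟩ := ((tendsto_order.1 h1).2 a ha).exists
    exact eventually_powerAverage_lt hs0 hs1 hsum h (B := Real.exp 1)
      (fun x _ => abs_karamataFun_le x) (continuous_karamataRamp 1 k).continuousOn
      (fun x _ => karamataFun_le_ramp k x) hk

/-- For `δ = t / log N` the Karamata function selects the terms that are at least `N ^ (-1 / t)`. -/
theorem rpow_mul_karamataFun {x N t : ℝ} (hx : 0 ≤ x) (hN : 1 < N) (ht : 0 < t) :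
    x ^ (1 + t / Real.log N) * karamataFun (x ^ (t / Real.log N)) =
      if N ^ (-1 / t) ≤ x then x else 0 := by
  have hl := Real.log_pos hN
  have hd : 0 < t / Real.log N := by positivity
  have hN0 : 0 < N := by linarith
  have h1 : (N ^ (-1 / t)) ^ (t / Real.log N) = Real.exp (-1) := by
    rw [← Real.rpow_mul hN0.le, Real.rpow_def_of_pos hN0]
    congr 1
    field_simp
  have h2 : Real.exp (-1) ≤ x ^ (t / Real.log N) ↔ N ^ (-1 / t) ≤ x := by
    rw [← h1, Real.rpow_le_rpow_iff (by positivity) hx hd]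
  rw [karamataFun]
  simp only [h2]
  split_ifs with h
  · have hx' : 0 < x := (by positivity : 0 < N ^ (-1 / t)).trans_le h
    rw [Real.rpow_add hx', Real.rpow_one]
    field_simp
  · rw [mul_zero]

/-- The Tauberian theorem for sequences in `[0, 1]`, where the test functions live. -/
theorem tendsto_sum_div_log_of_le_one {s : ℕ → ℝ} (hs : Antitone s) (hs0 : ∀ n, 0 ≤ s n)
    (hs1 : ∀ n, s n ≤ 1) (hsum : ∀ p : ℝ, 1 < p → Summable fun n => s n ^ p)
    (hO : (fun N : ℕ => ∑ n ∈ Finset.range N, s n) =O[atTop] fun N : ℕ => Real.log (N : ℝ)) {L : ℝ}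
    (h : Tendsto (fun p : ℝ => (p - 1) * ∑' n, s n ^ p) (𝓝[>] 1) (𝓝 L)) :
    Tendsto (fun N : ℕ => (∑ n ∈ Finset.range N, s n) / Real.log N) atTop (𝓝 L) := by
  have hlogtop : Tendsto (fun N : ℕ => Real.log N) atTop atTop :=
    Real.tendsto_log_atTop.comp tendsto_natCast_atTop_atTop
  have hM : ∀ t : ℝ, 0 < t → Tendsto (fun N : ℕ => t / Real.log N *
      ∑' n, if (N : ℝ) ^ (-1 / t) ≤ s n then s n else 0) atTop (𝓝 L) := by
    intro t ht
    have h1 : Tendsto (fun N : ℕ => t / Real.log N) atTop (𝓝[>] 0) := by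
      refine tendsto_nhdsWithin_iff.2 ⟨tendsto_const_nhds.div_atTop hlogtop, ?_⟩
      filter_upwards [hlogtop.eventually_gt_atTop 0] with N hN
      exact div_pos ht hN
    refine ((tendsto_powerAverage_karamataFun hs0 hs1 hsum h).comp h1).congr' ?_
    filter_upwards [eventually_ge_atTop 2] with N hN
    have hN1 : (1 : ℝ) < N := by exact_mod_cast hN
    simp only [powerAverage, Function.comp_apply, rpow_mul_karamataFun (hs0 _) hN1 ht]
  have hMs : ∀ N : ℕ, 2 ≤ N → Summable fun n => if (N : ℝ) ^ (-1 / (1 : ℝ)) ≤ s n then s n else 0 :=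
    fun N hN => by
      have hN1 : (1 : ℝ) < N := by exact_mod_cast hN
      have h1 := summable_powerAverage hs0 hs1 hsum (fun x _ => abs_karamataFun_le x)
        (div_pos one_pos (Real.log_pos hN1))
      simpa only [rpow_mul_karamataFun (hs0 _) hN1 one_pos] using h1
  refine tendsto_order.2 ⟨fun a ha => ?_, fun a ha => ?_⟩
  · obtain ⟨t, ht1, hta⟩ : ∃ t > 1, a < L / t := by
      have h1 : Tendsto (fun t : ℝ => L / t) (𝓝[>] 1) (𝓝 L) := by
        have : Tendsto (fun t : ℝ => L / t) (𝓝 1) (𝓝 (L / 1)) :=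
          tendsto_const_nhds.div tendsto_id one_ne_zero
        rw [div_one] at this
        exact this.mono_left nhdsWithin_le_nhds
      obtain ⟨t, h2, h3⟩ :=
        (((tendsto_order.1 h1).1 a ha).and self_mem_nhdsWithin).exists
      exact ⟨t, h3, h2⟩
    have ht0 : 0 < t := by linarith
    obtain ⟨C, hC, hCO⟩ := hO.exists_pos
    have hpow : 0 < 1 - 1 / t := by
      have : 1 / t < 1 := by rw [div_lt_one ht0]; exact ht1
      linarith
    have hlo := ((isLittleO_log_rpow_atTop hpow).comp_tendsto
      (tendsto_natCast_atTop_atTop (R := ℝ))).def (c := 1 / (2 * C)) (by positivity)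
    have h2 := (hM t ht0).div_const t
    filter_upwards [hCO.bound, hlo, eventually_ge_atTop 2, (tendsto_order.1 h2).1 a hta] with
      N hN1 hN2 hN3 hN4
    have hN0 : (0 : ℝ) < N := by exact_mod_cast (by omega : 0 < N)
    have hlog : 0 < Real.log N := Real.log_pos (by exact_mod_cast hN3)
    refine hN4.trans_le ?_
    -- `N * s N ≤ ∑ s n = O(log N)` is eventually smaller than `N * N ^ (-1 / t)`, as `t > 1`.
    have hsmall : ∀ n, n ∉ Finset.range N → ¬ (N : ℝ) ^ (-1 / t) ≤ s n := by
      intro n hn hle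
      rw [Finset.mem_range, not_lt] at hn
      have e1 : (N : ℝ) * s n ≤ ∑ n ∈ Finset.range N, s n := by
        have := Finset.card_nsmul_le_sum (Finset.range N) s (s n)
          fun m hm => hs ((Finset.mem_range.1 hm).le.trans hn)
        simpa using this
      rw [Real.norm_of_nonneg hlog.le] at hN1
      simp only [Function.comp_apply] at hN2
      rw [Real.norm_of_nonneg hlog.le, Real.norm_of_nonneg (by positivity)] at hN2
      have e2 : (N : ℝ) * (N : ℝ) ^ (-1 / t) = (N : ℝ) ^ (1 - 1 / t) := by
        rw [sub_eq_add_neg, Real.rpow_add hN0, Real.rpow_one, neg_div]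
      have e3 := mul_le_mul_of_nonneg_left hle hN0.le
      rw [e2] at e3
      have e4 := mul_le_mul_of_nonneg_left hN2 hC.le
      have e5 : C * (1 / (2 * C) * (N : ℝ) ^ (1 - 1 / t)) = (N : ℝ) ^ (1 - 1 / t) / 2 := by
        field_simp
      have e6 : 0 < (N : ℝ) ^ (1 - 1 / t) := by positivity
      linarith [Real.le_norm_self (∑ n ∈ Finset.range N, s n)]
    rw [tsum_eq_sum (s := Finset.range N) fun n hn => if_neg (hsmall n hn)]
    have e7 : (∑ n ∈ Finset.range N, if (N : ℝ) ^ (-1 / t) ≤ s n then s n else 0) ≤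
        ∑ n ∈ Finset.range N, s n := Finset.sum_le_sum fun n _ => by
      split_ifs
      · exact le_rfl
      · exact hs0 n
    rw [div_mul_eq_mul_div, div_div, mul_comm (Real.log _), mul_div_mul_left _ _ ht0.ne']
    gcongr
  · have h1 := (hM 1 one_pos).add (tendsto_const_nhds (x := (1 : ℝ)).div_atTop hlogtop)
    rw [add_zero] at h1
    filter_upwards [(tendsto_order.1 h1).2 a ha, eventually_ge_atTop 2] with N hN1 hN2
    refine lt_of_le_of_lt ?_ hN1
    have hN0 : (0 : ℝ) < N := by exact_mod_cast (by omega : 0 < N)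
    have hlog : 0 < Real.log N := Real.log_pos (by exact_mod_cast hN2)
    rw [div_mul_eq_mul_div, one_mul, ← add_div]
    gcongr
    -- The terms below `1 / N` contribute at most `1` to the sum of the first `N` terms.
    have e1 : ∀ n, s n ≤ (if (N : ℝ) ^ (-1 / (1 : ℝ)) ≤ s n then s n else 0) + 1 / N := fun n => by
      split_ifs with hc
      · have : 0 ≤ 1 / (N : ℝ) := by positivity
        linarith
      · rw [div_one, Real.rpow_neg_one, ← one_div] at hc
        linarith
    calc ∑ n ∈ Finset.range N, s n
        ≤ ∑ n ∈ Finset.range N,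
          ((if (N : ℝ) ^ (-1 / (1 : ℝ)) ≤ s n then s n else 0) + 1 / N) :=
          Finset.sum_le_sum fun n _ => e1 n
      _ = (∑ n ∈ Finset.range N, if (N : ℝ) ^ (-1 / (1 : ℝ)) ≤ s n then s n else 0) + 1 := by
          rw [Finset.sum_add_distrib]
          simp [hN0.ne']
      _ ≤ _ := by
          gcongr
          refine (hMs N hN2).sum_le_tsum _ fun n _ => ?_
          split_ifs
          · exact hs0 n
          · exact le_rfl

/-- The Tauberian theorem: the residue of `∑ s n ^ p` at `p = 1` determines the logarithmic means.
The general case reduces to sequences in `[0, 1]` by scaling. -/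
theorem tendsto_sum_div_log_of_tendsto_sub_mul_tsum_rpow {s : ℕ → ℝ} (hs : Antitone s)
    (hs0 : ∀ n, 0 ≤ s n) (hsum : ∀ p : ℝ, 1 < p → Summable fun n => s n ^ p)
    (hO : (fun N : ℕ => ∑ n ∈ Finset.range N, s n) =O[atTop] fun N : ℕ => Real.log (N : ℝ)) {L : ℝ}
    (h : Tendsto (fun p : ℝ => (p - 1) * ∑' n, s n ^ p) (𝓝[>] 1) (𝓝 L)) :
    Tendsto (fun N : ℕ => (∑ n ∈ Finset.range N, s n) / Real.log N) atTop (𝓝 L) := by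
  set c := (1 + s 0)⁻¹ with hc
  have hc0 : 0 < c := inv_pos.2 (by linarith [hs0 0])
  have hrpow : ∀ (p : ℝ) n, (c * s n) ^ p = c ^ p * s n ^ p := fun p n =>
    Real.mul_rpow hc0.le (hs0 n)
  have h1 : Tendsto (fun p : ℝ => (p - 1) * ∑' n, (c * s n) ^ p) (𝓝[>] 1) (𝓝 (c * L)) := by
    have h2 : Tendsto (fun p : ℝ => c ^ p) (𝓝 1) (𝓝 (c ^ (1 : ℝ))) :=
      tendsto_const_nhds.rpow tendsto_id (Or.inr one_pos)
    rw [Real.rpow_one] at h2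
    refine ((h2.mono_left nhdsWithin_le_nhds).mul h).congr fun p => ?_
    simp only [hrpow, tsum_mul_left]
    ring
  have h3 := tendsto_sum_div_log_of_le_one (s := fun n => c * s n)
    (fun m n hmn => mul_le_mul_of_nonneg_left (hs hmn) hc0.le)
    (fun n => mul_nonneg hc0.le (hs0 n))
    (fun n => by
      rw [hc, inv_mul_le_iff₀ (by linarith [hs0 0])]
      linarith [hs n.zero_le])
    (fun p hp => by simpa only [hrpow] using (hsum p hp).mul_left (c ^ p))
    (by simpa only [← Finset.mul_sum] using hO.const_mul_left c) h1
  refine ((h3.const_mul c⁻¹).congr fun N => ?_).trans (by rw [inv_mul_cancel_left₀ hc0.ne'])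
  rw [← Finset.mul_sum, mul_div_assoc, inv_mul_cancel_left₀ hc0.ne']

/-! ### Eigenspaces and singular values of positive compact operators -/

section Eigenspaces

/-- The functional calculus acts on eigenvectors by applying the function to the eigenvalue. -/
theorem cfc_apply_of_eigenvector {H : Type*} [NormedAddCommGroup H] [InnerProductSpace ℂ H]
    [CompleteSpace H] {A : H →L[ℂ] H} (hA : IsSelfAdjoint A) {ν : ℝ} {x : H}
    (hx : A x = (ν : ℂ) • x) (hx0 : x ≠ 0) {f : ℝ → ℝ} (hf : ContinuousOn f (spectrum ℝ A)) :
    cfc f A x = ((f ν : ℝ) : ℂ) • x := by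
  have hν : ν ∈ spectrum ℝ A := by
    rw [spectrum.mem_iff]
    intro hu
    obtain ⟨u, hu⟩ := hu
    have h1 : (u : H →L[ℂ] H) x = 0 := by
      rw [hu, sub_apply, hx, Algebra.algebraMap_eq_smul_one]
      simp
    have h2 : ((↑u⁻¹ : H →L[ℂ] H) * (u : H →L[ℂ] H)) x = x := by simp
    rw [mul_apply_eq_comp, h1, map_zero] at h2
    exact hx0 h2.symm
  rw [cfc_apply f A hA hf]
  have key : ∀ g : C(spectrum ℝ A, ℝ), cfcHom hA g x = ((g ⟨ν, hν⟩ : ℝ) : ℂ) • x := by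
    intro g
    have hid : cfcHom hA (.restrict (spectrum ℝ A) <| .id ℝ) x = (ν : ℂ) • x := by
      rw [cfcHom_id hA, hx]
    induction g using ContinuousMap.induction_on_of_compact with
    | const r =>
      have : cfcHom hA (.const (spectrum ℝ A) r) = algebraMap ℝ (H →L[ℂ] H) r :=
        AlgHomClass.commutes (cfcHom hA) r
      rw [this, Algebra.algebraMap_eq_smul_one]
      simp
    | id => exact hid
    | star_id => rw [map_star, cfcHom_id hA, hA.star_eq, hx]; rfl
    | add f g hf hg => simp [map_add, hf, hg, add_smul]
    | mul f g hf hg =>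
      rw [map_mul, mul_apply_eq_comp, hg, map_smul, hf, smul_smul,
        ContinuousMap.mul_apply, Complex.ofReal_mul, mul_comm]
    | frequently f hf =>
      have hc : IsClosed {g : C(spectrum ℝ A, ℝ) |
          cfcHom hA g x = ((g ⟨ν, hν⟩ : ℝ) : ℂ) • x} := by
        refine isClosed_eq ?_ ?_
        · exact (ContinuousLinearMap.apply ℂ H x).continuous.comp (cfcHom_continuous hA)
        · exact (Complex.continuous_ofReal.comp
            (continuous_eval_const (⟨ν, hν⟩ : spectrum ℝ A))).smul continuous_const
      exact hc.closure_subset (mem_closure_iff_frequently.2 hf)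
  exact key _

open Module.End

variable {H : Type*} [NormedAddCommGroup H] [InnerProductSpace ℂ H]

theorem rpow_apply_of_eigenvector [CompleteSpace H] {A : H →L[ℂ] H} (hA : A.IsPositive)
    {ν p : ℝ} (hp : 0 ≤ p)
    {x : H} (hx : A x = (ν : ℂ) • x) : (A ^ p) x = ((ν ^ p : ℝ) : ℂ) • x := by
  rcases eq_or_ne x 0 with rfl | hx0
  · simp
  have h0 : 0 ≤ A := (ContinuousLinearMap.nonneg_iff_isPositive A).2 hA
  rw [CFC.rpow_eq_cfc_real h0]
  exact cfc_apply_of_eigenvector hA.isSelfAdjoint hx hx0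
    (continuousOn_id.rpow_const fun _ _ => Or.inr hp)

/-- The reverse inclusion comes from `(A ^ p) ^ p⁻¹ = A`. -/
theorem eigenspace_rpow [CompleteSpace H] {A : H →L[ℂ] H} (hA : A.IsPositive)
    {ν p : ℝ} (hν : 0 ≤ ν) (hp : 0 < p) :
    eigenspace ((A ^ p : H →L[ℂ] H) : Module.End ℂ H) ((ν ^ p : ℝ) : ℂ) =
      eigenspace (A : Module.End ℂ H) (ν : ℂ) := by
  have h0 : 0 ≤ A := (ContinuousLinearMap.nonneg_iff_isPositive A).2 hA
  ext x
  simp only [mem_eigenspace_iff, ContinuousLinearMap.coe_coe]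
  refine ⟨fun h => ?_, rpow_apply_of_eigenvector hA hp.le⟩
  have h1 := rpow_apply_of_eigenvector
    ((ContinuousLinearMap.nonneg_iff_isPositive (A ^ p)).1 CFC.rpow_nonneg)
    (inv_nonneg.2 hp.le) h
  rwa [CFC.rpow_rpow_of_exponent_nonneg A p p⁻¹ hp.le (inv_nonneg.2 hp.le) h0,
    mul_inv_cancel₀ hp.ne', CFC.rpow_one A h0, Real.rpow_rpow_inv hν hp.ne'] at h1

theorem eigenspace_adjoint_comp_self [CompleteSpace H] {A : H →L[ℂ] H} (hA : A.IsPositive)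
    {μ : ℝ} (hμ : 0 ≤ μ) :
    eigenspace ((ContinuousLinearMap.adjoint A ∘L A : H →L[ℂ] H) : Module.End ℂ H)
      ((μ ^ 2 : ℝ) : ℂ) = eigenspace (A : Module.End ℂ H) (μ : ℂ) := by
  have h0 : 0 ≤ A := (ContinuousLinearMap.nonneg_iff_isPositive A).2 hA
  have h1 : (ContinuousLinearMap.adjoint A ∘L A : H →L[ℂ] H) = A ^ (2 : ℝ) := by
    rw [hA.isSelfAdjoint.adjoint_eq, ← Nat.cast_ofNat, CFC.rpow_natCast A 2 h0, pow_two]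
    rfl
  rw [h1, ← eigenspace_rpow hA hμ two_pos, Real.rpow_two]

/-- The span of the eigenspaces of `A` for the real eigenvalues larger than `t`. -/
noncomputable def spectralSpan (A : H →L[ℂ] H) (t : ℝ) : Submodule ℂ H :=
  ⨆ μ ∈ Set.Ioi t, eigenspace (A : Module.End ℂ H) ((μ : ℝ) : ℂ)

theorem singularValue_eq_sInf [CompleteSpace H] {A : H →L[ℂ] H} (hA : A.IsPositive) (n : ℕ) :
    singularValue A n =
      sInf {t : ℝ | 0 ≤ t ∧ Module.rank ℂ (spectralSpan A t) ≤ (n : Cardinal)} := by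
  unfold singularValue
  congr 1
  ext t
  refine and_congr_right fun ht => ?_
  rw [spectralSpan]
  have : ∀ μ ∈ Set.Ioi t, eigenspace
      ((ContinuousLinearMap.adjoint A ∘L A : H →L[ℂ] H) : Module.End ℂ H) (((μ : ℝ) ^ 2 : ℝ) : ℂ) =
      eigenspace (A : Module.End ℂ H) (μ : ℂ) := fun μ hμ =>
    eigenspace_adjoint_comp_self hA (ht.trans (le_of_lt hμ))
  rw [biSup_congr this]

theorem eigenspace_le_spectralSpan (A : H →L[ℂ] H) {t μ : ℝ} (h : t < μ) :
    eigenspace (A : Module.End ℂ H) (μ : ℂ) ≤ spectralSpan A t :=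
  le_iSup₂_of_le μ h le_rfl

theorem spectralSpan_antitone (A : H →L[ℂ] H) : Antitone (spectralSpan A) := fun _ _ h =>
  iSup₂_le fun _ hμ => eigenspace_le_spectralSpan A (h.trans_lt hμ)

/-- The eigenspaces are orthogonal, so `A` is bounded below by `t` on their span. -/
theorem mul_norm_le_of_mem_spectralSpan {A : H →L[ℂ] H} (hA : A.IsPositive) {t : ℝ} (ht : 0 ≤ t)
    {x : H} (hx : x ∈ spectralSpan A t) : t * ‖x‖ ≤ ‖A x‖ := by
  classical
  have hV : OrthogonalFamily ℂ (fun μ : Set.Ioi t => eigenspace (A : Module.End ℂ H) ((μ : ℝ) : ℂ))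
      fun μ => (eigenspace (A : Module.End ℂ H) ((μ : ℝ) : ℂ)).subtypeₗᵢ :=
    hA.isSymmetric.orthogonalFamily_eigenspaces.comp
      (Complex.ofReal_injective.comp Subtype.coe_injective)
  rw [spectralSpan, iSup_subtype', Submodule.mem_iSup_iff_exists_dfinsupp'] at hx
  obtain ⟨f, rfl⟩ := hx
  have h1 : ‖f.sum fun _ y => (y : H)‖ ^ 2 = ∑ i ∈ f.support, ‖f i‖ ^ 2 := hV.norm_sum f f.support
  have h2 : ‖A (f.sum fun _ y => (y : H))‖ ^ 2 =
      ∑ i ∈ f.support, ‖((i : ℝ) : ℂ) • f i‖ ^ 2 := by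
    rw [← hV.norm_sum (fun i => ((i : ℝ) : ℂ) • f i) f.support, DFinsupp.sum, map_sum]
    congr 2
    refine Finset.sum_congr rfl fun i _ => ?_
    simpa using mem_eigenspace_iff.1 (f i).2
  refine le_of_sq_le_sq ?_ (norm_nonneg _)
  rw [mul_pow, h1, h2, Finset.mul_sum]
  refine Finset.sum_le_sum fun i _ => ?_
  rw [norm_smul, mul_pow, Complex.norm_real]
  gcongr
  exact (le_of_lt i.2).trans (Real.le_norm_self _)

/-- On the closure of the span, `A` is compact and bounded below, so the closure is locally
compact. -/
theorem finiteDimensional_spectralSpan [CompleteSpace H] {A : H →L[ℂ] H} (hA : A.IsPositive)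
    (hc : IsCompactOperator A) {t : ℝ} (ht : 0 < t) :
    FiniteDimensional ℂ (spectralSpan A t) := by
  set V := (spectralSpan A t).topologicalClosure
  have hbound : ∀ x ∈ V, t * ‖x‖ ≤ ‖A x‖ := by
    intro x hx
    refine closure_minimal (s := (spectralSpan A t : Set H)) (t := {x | t * ‖x‖ ≤ ‖A x‖})
      (fun y hy => mul_norm_le_of_mem_spectralSpan hA ht.le hy)
      (isClosed_le (by fun_prop) (by fun_prop)) hx
  have : CompleteSpace V := (Submodule.isClosed_topologicalClosure _).completeSpace_coe
  set f : V →L[ℂ] H := A ∘L V.subtypeL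
  have hf : IsCompactOperator f := hc.comp_clm V.subtypeL
  have hanti : AntilipschitzWith (⟨t, ht.le⟩⁻¹ : NNReal) f :=
    f.antilipschitz_of_bound fun x => by
      have := hbound x x.2
      change ‖x‖ ≤ t⁻¹ * ‖A x‖
      rw [inv_mul_eq_div, le_div_iff₀ ht, mul_comm]
      exact this
  obtain ⟨K, hK, hKn⟩ := hf
  have hid : IsCompactOperator (id : V → V) :=
    ⟨f ⁻¹' K, (hanti.isClosedEmbedding f.uniformContinuous).isCompact_preimage hK, hKn⟩
  have : FiniteDimensional ℂ V := FiniteDimensional.of_isCompactOperator_id hid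
  exact Submodule.finiteDimensional_of_le (Submodule.le_topologicalClosure _)

theorem finite_eigenvalues_gt [CompleteSpace H] {A : H →L[ℂ] H} (hA : A.IsPositive)
    (hc : IsCompactOperator A) {t : ℝ} (ht : 0 < t) :
    {μ : ℝ | t < μ ∧ eigenspace (A : Module.End ℂ H) (μ : ℂ) ≠ ⊥}.Finite := by
  have := finiteDimensional_spectralSpan hA hc ht
  set F := {μ : ℝ | t < μ ∧ eigenspace (A : Module.End ℂ H) (μ : ℂ) ≠ ⊥} with hF
  have h1 : ∀ μ : F, ∃ v : spectralSpan A t,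
      HasEigenvector (A : Module.End ℂ H) ((μ : ℝ) : ℂ) (v : H) := fun μ => by
    obtain ⟨v, hv, hv0⟩ := Submodule.exists_mem_ne_zero_of_ne_bot μ.2.2
    exact ⟨⟨v, eigenspace_le_spectralSpan A μ.2.1 hv⟩, hv, hv0⟩
  choose v hv using h1
  have h2 : LinearIndependent ℂ fun μ : F => (v μ : H) :=
    eigenvectors_linearIndependent' (A : Module.End ℂ H) (fun μ : F => ((μ : ℝ) : ℂ))
      (Complex.ofReal_injective.comp Subtype.coe_injective) _ hv
  have h3 : LinearIndependent ℂ v := LinearIndependent.of_comp (spectralSpan A t).subtype h2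
  exact Set.finite_coe_iff.1 h3.finite_of_isNoetherian

theorem exists_punctured_eigenvalue_free [CompleteSpace H] {A : H →L[ℂ] H} (hA : A.IsPositive)
    (hc : IsCompactOperator A) {x : ℝ} (hx : 0 < x) :
    ∃ ε > 0, ε < x ∧ ∀ μ : ℝ, x - ε < μ → μ ≤ x + ε → μ ≠ x →
      eigenspace (A : Module.End ℂ H) (μ : ℂ) = ⊥ := by
  have hF := (finite_eigenvalues_gt hA hc (half_pos hx)).subset (Set.sdiff_subset (t := {x}))
  have h1 := hF.isClosed.isOpen_compl.mem_nhds (x := x) (by simp)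
  obtain ⟨ε, hε, h2⟩ := Metric.mem_nhds_iff.1 h1
  refine ⟨min (ε / 2) (x / 2), by positivity, (min_le_right _ _).trans_lt (by linarith),
    fun μ h3 h4 h5 => ?_⟩
  have h6 := min_le_left (ε / 2) (x / 2)
  have h7 := min_le_right (ε / 2) (x / 2)
  by_contra h8
  refine h2 (a := μ) ?_ ⟨⟨by linarith, h8⟩, h5⟩
  rw [Metric.mem_ball, Real.dist_eq, abs_lt]
  constructor <;> linarith

theorem exists_spectralSpan_eq_right [CompleteSpace H] {A : H →L[ℂ] H} (hA : A.IsPositive)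
    (hc : IsCompactOperator A) {t : ℝ} (ht : 0 < t) :
    ∃ t' > t, spectralSpan A t' = spectralSpan A t := by
  obtain ⟨ε, hε, -, h⟩ := exists_punctured_eigenvalue_free hA hc ht
  refine ⟨t + ε, by linarith, le_antisymm (spectralSpan_antitone A (by linarith)) ?_⟩
  refine iSup₂_le fun μ (hμ : t < μ) => ?_
  rcases le_or_gt μ (t + ε) with h1 | h1
  · rw [h μ (by linarith) h1 hμ.ne']
    exact bot_le
  · exact eigenspace_le_spectralSpan A h1

theorem exists_spectralSpan_eq_sup [CompleteSpace H] {A : H →L[ℂ] H} (hA : A.IsPositive)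
    (hc : IsCompactOperator A) {x : ℝ} (hx : 0 < x) :
    ∃ t₀ < x, 0 < t₀ ∧ ∀ t, t₀ ≤ t → t < x →
      spectralSpan A t = eigenspace (A : Module.End ℂ H) (x : ℂ) ⊔ spectralSpan A x := by
  obtain ⟨ε, hε, hεx, h⟩ := exists_punctured_eigenvalue_free hA hc hx
  refine ⟨x - ε, by linarith, by linarith, fun t h1 h2 => le_antisymm ?_
    (sup_le (eigenspace_le_spectralSpan A h2) (spectralSpan_antitone A h2.le))⟩
  refine iSup₂_le fun μ (hμ : t < μ) => ?_
  rcases lt_trichotomy μ x with h3 | rfl | h3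
  · rw [h μ (by linarith) (by linarith) h3.ne]
    exact bot_le
  · exact le_sup_left
  · exact (eigenspace_le_spectralSpan A h3).trans le_sup_right

theorem disjoint_eigenspace_spectralSpan (A : H →L[ℂ] H) (x : ℝ) :
    Disjoint (eigenspace (A : Module.End ℂ H) (x : ℂ)) (spectralSpan A x) :=
  (((eigenspaces_iSupIndep (A : Module.End ℂ H)).comp Complex.ofReal_injective).disjoint_biSup
    (x := x) (y := Set.Ioi x) (by simp))

theorem spectralSpan_norm (A : H →L[ℂ] H) : spectralSpan A ‖A‖ = ⊥ := by
  rw [eq_bot_iff]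
  refine iSup₂_le fun μ (hμ : ‖A‖ < μ) x hx => ?_
  rw [mem_eigenspace_iff, ContinuousLinearMap.coe_coe] at hx
  have h1 := A.le_opNorm x
  rw [hx, norm_smul, Complex.norm_real] at h1
  rw [Submodule.mem_bot]
  by_contra h0
  have h2 := le_of_mul_le_mul_right h1 (norm_pos_iff.2 h0)
  linarith [Real.le_norm_self μ]

theorem singularValue_set_nonempty [CompleteSpace H] (A : H →L[ℂ] H) (n : ℕ) :
    {t : ℝ | 0 ≤ t ∧ Module.rank ℂ (spectralSpan A t) ≤ (n : Cardinal)}.Nonempty :=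
  ⟨‖A‖, norm_nonneg A, by rw [spectralSpan_norm]; simp⟩

theorem singularValue_nonneg [CompleteSpace H] (A : H →L[ℂ] H) (n : ℕ) : 0 ≤ singularValue A n :=
  Real.sInf_nonneg fun _ h => h.1

theorem singularValue_antitone [CompleteSpace H] {A : H →L[ℂ] H} (hA : A.IsPositive) :
    Antitone (singularValue A) :=
  fun m n hmn => by
    rw [singularValue_eq_sInf hA, singularValue_eq_sInf hA]
    exact csInf_le_csInf ⟨0, fun _ h => h.1⟩ (singularValue_set_nonempty A m)
      fun t ht => ⟨ht.1, ht.2.trans (by exact_mod_cast hmn)⟩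

theorem lt_singularValue_iff [CompleteSpace H] {A : H →L[ℂ] H} (hA : A.IsPositive)
    (hc : IsCompactOperator A) {t : ℝ} (ht : 0 < t) (n : ℕ) :
    t < singularValue A n ↔ n < Module.finrank ℂ (spectralSpan A t) := by
  rw [singularValue_eq_sInf hA]
  constructor
  · intro h
    have := finiteDimensional_spectralSpan hA hc ht
    have h1 := notMem_of_lt_csInf h ⟨0, fun _ h => h.1⟩
    have h2 : ¬ Module.rank ℂ (spectralSpan A t) ≤ (n : Cardinal) := fun h2 => h1 ⟨ht.le, h2⟩
    rw [← Module.finrank_eq_rank, Nat.cast_le] at h2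
    exact not_le.1 h2
  · intro h
    obtain ⟨t', ht', he⟩ := exists_spectralSpan_eq_right hA hc ht
    refine ht'.trans_le (le_csInf (singularValue_set_nonempty A n) fun u hu => ?_)
    by_contra hlt
    have hle : spectralSpan A t' ≤ spectralSpan A u := spectralSpan_antitone A (not_le.1 hlt).le
    have h1 := (Submodule.rank_mono hle).trans hu.2
    have := finiteDimensional_spectralSpan hA hc ht
    rw [he, ← Module.finrank_eq_rank, Nat.cast_le] at h1
    omega

/-- Each positive eigenvalue `x` occurs among the singular values as often as its multiplicity says,
at consecutive indices. -/
theorem setOf_singularValue_eq [CompleteSpace H] {A : H →L[ℂ] H} (hA : A.IsPositive)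
    (hc : IsCompactOperator A) {x : ℝ} (hx : 0 < x) :
    {n | singularValue A n = x} = Set.Ico (Module.finrank ℂ (spectralSpan A x))
      (Module.finrank ℂ (spectralSpan A x) +
        Module.finrank ℂ (eigenspace (A : Module.End ℂ H) (x : ℂ))) := by
  obtain ⟨t₀, h0x, h0, h⟩ := exists_spectralSpan_eq_sup hA hc hx
  have := finiteDimensional_spectralSpan hA hc hx
  have : FiniteDimensional ℂ (eigenspace (A : Module.End ℂ H) (x : ℂ)) :=
    have := finiteDimensional_spectralSpan hA hc h0
    Submodule.finiteDimensional_of_le (eigenspace_le_spectralSpan A h0x)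
  have hdim : ∀ t, t₀ ≤ t → t < x → Module.finrank ℂ (spectralSpan A t) =
      Module.finrank ℂ (spectralSpan A x) +
        Module.finrank ℂ (eigenspace (A : Module.End ℂ H) (x : ℂ)) := fun t h1 h2 => by
    have h3 := Submodule.finrank_sup_add_finrank_inf_eq
      (eigenspace (A : Module.End ℂ H) (x : ℂ)) (spectralSpan A x)
    rw [(disjoint_eigenspace_spectralSpan A x).eq_bot, finrank_bot, add_zero] at h3
    rw [h t h1 h2, h3, add_comm]
  ext n
  rw [Set.mem_ofPred_eq, Set.mem_Ico]
  constructor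
  · rintro rfl
    exact ⟨not_lt.1 fun h1 => lt_irrefl _ ((lt_singularValue_iff hA hc hx n).2 h1),
      hdim t₀ le_rfl h0x ▸ (lt_singularValue_iff hA hc h0 n).1 h0x⟩
  · rintro ⟨h1, h2⟩
    refine le_antisymm (not_lt.1 fun h3 => h1.not_gt ((lt_singularValue_iff hA hc hx n).1 h3)) ?_
    refine le_of_forall_lt fun c hcx => ?_
    refine (le_max_left c t₀).trans_lt ((lt_singularValue_iff hA hc
      (h0.trans_le (le_max_right _ _)) n).2 ?_)
    rwa [hdim _ (le_max_right _ _) (max_lt hcx h0x)]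

theorem maxGenEigenspace_smul (f : Module.End ℂ H) {z : ℂ} (hz : z ≠ 0) (ν : ℂ) :
    maxGenEigenspace (z • f) (z * ν) = maxGenEigenspace f ν := by
  ext x
  simp only [mem_maxGenEigenspace]
  refine exists_congr fun k => ?_
  rw [mul_smul, ← smul_sub, smul_pow, LinearMap.smul_apply,
    smul_eq_zero_iff_right (pow_ne_zero k hz)]

theorem maxGenEigenspace_eq_eigenspace_of_isPositive {A : H →L[ℂ] H} (hA : A.IsPositive) (ν : ℂ) :
    maxGenEigenspace (A : Module.End ℂ H) ν = eigenspace (A : Module.End ℂ H) ν :=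
  hA.isSymmetric.isFinitelySemisimple.maxGenEigenspace_eq_eigenspace ν

theorem exists_real_of_eigenspace_ne_bot {A : H →L[ℂ] H} (hA : A.IsPositive) {ν : ℂ}
    (h : eigenspace (A : Module.End ℂ H) ν ≠ ⊥) : ∃ r : ℝ, 0 ≤ r ∧ ν = r := by
  have h1 : HasEigenvalue (A : Module.End ℂ H) ν := h
  obtain ⟨r, rfl⟩ := Complex.conj_eq_iff_real.1 (hA.isSymmetric.conj_eigenvalue_eq_self h1)
  exact ⟨r, eigenvalue_nonneg_of_nonneg h1 fun x => hA.re_inner_nonneg_right x, rfl⟩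

/-- The algebraic multiplicity of `c ≠ 0` as an eigenvalue of `z • A ^ p` is the number of indices
`n` with `z * s n ^ p = c`. -/
theorem ncard_fiber_eq_finrank [CompleteSpace H] {A : H →L[ℂ] H} (hA : A.IsPositive)
    (hc : IsCompactOperator A) {p : ℝ} (hp : 0 < p) (z : ℂ) {c : ℂ} (hc0 : c ≠ 0) :
    {n | z * ((singularValue A n ^ p : ℝ) : ℂ) = c}.Finite ∧
      {n | z * ((singularValue A n ^ p : ℝ) : ℂ) = c}.ncard =
        Module.finrank ℂ (maxGenEigenspace ((z • A ^ p : H →L[ℂ] H) : Module.End ℂ H) c) := by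
  have hAp : (A ^ p).IsPositive :=
    (ContinuousLinearMap.nonneg_iff_isPositive (A ^ p)).1 CFC.rpow_nonneg
  rcases eq_or_ne z 0 with rfl | hz
  · have h0 : ContinuousLinearMap.IsPositive (0 : H →L[ℂ] H) :=
      ContinuousLinearMap.isPositive_zero
    have h1 : eigenspace ((0 : H →L[ℂ] H) : Module.End ℂ H) c = ⊥ := by
      rw [eq_bot_iff]
      intro x hx
      simpa [mem_eigenspace_iff, hc0, eq_comm] using hx
    rw [zero_smul, maxGenEigenspace_eq_eigenspace_of_isPositive h0, h1]
    simp [hc0.symm]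
  have hcz : c = z * (c / z) := by field_simp
  have h1 : maxGenEigenspace ((z • A ^ p : H →L[ℂ] H) : Module.End ℂ H) c =
      eigenspace ((A ^ p : H →L[ℂ] H) : Module.End ℂ H) (c / z) := by
    rw [← maxGenEigenspace_eq_eigenspace_of_isPositive hAp,
      ← maxGenEigenspace_smul _ hz (c / z), ← hcz]
    rfl
  rw [h1]
  by_cases hx : ∃ x : ℝ, 0 < x ∧ c / z = ((x ^ p : ℝ) : ℂ)
  · obtain ⟨x, hx, hxe⟩ := hx
    have h2 : {n | z * ((singularValue A n ^ p : ℝ) : ℂ) = c} = {n | singularValue A n = x} := by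
      ext n
      rw [Set.mem_ofPred_eq, Set.mem_ofPred_eq]
      nth_rewrite 1 [hcz]
      rw [hxe, mul_right_inj' hz, Complex.ofReal_inj,
        Real.rpow_left_inj (singularValue_nonneg A n) hx.le hp.ne']
    rw [h2, setOf_singularValue_eq hA hc hx, hxe, eigenspace_rpow hA hx.le hp]
    refine ⟨Set.finite_Ico _ _, ?_⟩
    rw [← Finset.coe_Ico, Set.ncard_coe_finset, Nat.card_Ico, Nat.add_sub_cancel_left]
  · have h2 : {n | z * ((singularValue A n ^ p : ℝ) : ℂ) = c} = ∅ := by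
      rw [Set.eq_empty_iff_forall_notMem]
      intro n hn
      rw [Set.mem_ofPred_eq] at hn
      refine hx ⟨singularValue A n, (singularValue_nonneg A n).lt_of_ne fun h0 => hc0 ?_, ?_⟩
      · rw [← hn, ← h0, Real.zero_rpow hp.ne']
        simp
      · rw [← hn, mul_div_cancel_left₀ _ hz]
    have h3 : eigenspace ((A ^ p : H →L[ℂ] H) : Module.End ℂ H) (c / z) = ⊥ := by
      by_contra hne
      obtain ⟨r, hr, hre⟩ := exists_real_of_eigenspace_ne_bot hAp hne
      have hr0 : r ≠ 0 := by
        rintro rfl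
        exact div_ne_zero hc0 hz (by simpa using hre)
      refine hx ⟨r ^ p⁻¹, Real.rpow_pos_of_pos (hr.lt_of_ne hr0.symm) _, ?_⟩
      rw [Real.rpow_inv_rpow hr hp.ne', hre]
    rw [h2, h3]
    simp

/-- Grouping an absolutely convergent product by the values of its terms; the value `0` may occur
infinitely often, but its factors are `1`. -/
theorem tprod_one_add_pow_eq_tprod {f : ℕ → ℂ} (hf : Summable f) {m : ℂ → ℕ}
    (hm : ∀ c ≠ 0, (f ⁻¹' {c}).Finite ∧ (f ⁻¹' {c}).ncard = m c) :
    ∏' c : ℂ, (1 + c) ^ m c = ∏' n, (1 + f n) := by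
  have h1 := (Complex.multipliable_one_add_of_summable hf).hasProd
  refine (((Equiv.sigmaFiberEquiv f).hasProd_iff.2 h1).sigma fun c => ?_).tprod_eq
  have h3 : ∀ b : {n // f n = c}, ((fun n => 1 + f n) ∘ Equiv.sigmaFiberEquiv f) ⟨c, b⟩ = 1 + c :=
    fun b => by simp [Equiv.sigmaFiberEquiv, b.2]
  simp only [h3]
  rcases eq_or_ne c 0 with rfl | hc0
  · simp only [add_zero, one_pow]
    exact hasProd_one
  obtain ⟨h4, h5⟩ := hm c hc0
  have : Finite {n // f n = c} := h4
  have := Fintype.ofFinite {n // f n = c}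
  have h6 : Fintype.card {n // f n = c} = m c := by
    rw [← h5, ← Nat.card_coe_set_eq, ← Nat.card_eq_fintype_card]
    rfl
  have h7 := hasProd_fintype fun _ : {n // f n = c} => 1 + c
  rwa [Finset.prod_const, Finset.card_univ, h6] at h7

/-- The determinant as a product over the singular values of `A`. -/
theorem detPow_eq_tprod [CompleteSpace H] {A : H →L[ℂ] H} (hA : A.IsPositive)
    (hc : IsCompactOperator A) {p : ℝ} (hp : 0 < p) (hs : Summable fun n => singularValue A n ^ p) (z : ℂ) :
    detPow p A z = ∏' n, (1 + z * ((singularValue A n ^ p : ℝ) : ℂ)) :=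
  tprod_one_add_pow_eq_tprod ((Complex.hasSum_ofReal.2 hs.hasSum).summable.mul_left z)
    fun _ hc0 => ncard_fiber_eq_finrank hA hc hp z hc0

end Eigenspaces

/-! ### Continued logarithms and the logarithm of the determinant -/

/-- Two continuous logarithms differ by a continuous function with values in `2πi ℤ`. -/
theorem IsLogAlong.unique {f : ℂ → ℂ} {z w w' : ℂ} (h : IsLogAlong f z w)
    (h' : IsLogAlong f z w') : w = w' := by
  obtain ⟨l, hl, hl0, rfl, he⟩ := h
  obtain ⟨l', hl', hl0', rfl, he'⟩ := h'
  have h2pi : (2 * Real.pi * Complex.I : ℂ) ≠ 0 := Complex.two_pi_I_ne_zero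
  have hmaps : Set.MapsTo (fun t => ((l t - l' t) / (2 * Real.pi * Complex.I)).re) (Set.Icc 0 1)
      (Set.range ((↑) : ℤ → ℝ)) := by
    intro t ht
    obtain ⟨n, hn⟩ := Complex.exp_eq_exp_iff_exists_int.1 ((he t ht).trans (he' t ht).symm)
    refine ⟨n, ?_⟩
    simp only [hn, add_sub_cancel_left, mul_div_cancel_right₀ _ h2pi, Complex.intCast_re]
  have h1 := isPreconnected_Icc.constant_of_mapsTo
    Int.isClosedEmbedding_coe_real.isInducing.isDiscrete_range
    (f := fun t => ((l t - l' t) / (2 * Real.pi * Complex.I)).re)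
    (Complex.continuous_re.comp_continuousOn ((hl.sub hl').div_const _)) hmaps
    (Set.right_mem_Icc.2 zero_le_one) (Set.left_mem_Icc.2 zero_le_one)
  have h1m : (1 : ℝ) ∈ Set.Icc (0 : ℝ) 1 := Set.right_mem_Icc.2 zero_le_one
  obtain ⟨n, hn⟩ := Complex.exp_eq_exp_iff_exists_int.1 ((he 1 h1m).trans (he' 1 h1m).symm)
  simp only [hn, hl0, hl0', sub_self, zero_div, Complex.zero_re, add_sub_cancel_left,
    mul_div_cancel_right₀ _ h2pi, Complex.intCast_re, Int.cast_eq_zero] at h1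
  rw [hn, h1]
  simp

theorem powBranch_eq_of_isLogAlong {f : ℂ → ℂ} {q : ℝ} {z w : ℂ} (h : IsLogAlong f z w) :
    powBranch f q z = Complex.exp (q * w) := by
  have hex : ∃ w, IsLogAlong f z w := ⟨w, h⟩
  rw [powBranch, dif_pos hex, hex.choose_spec.unique h]

/-- The logarithm `∑ log (1 + z sₙ ^ p)` of `∏ (1 + z sₙ ^ p)`, for small `z`. -/
noncomputable def logDet (s : ℕ → ℝ) (p : ℝ) (z : ℂ) : ℂ :=
  ∑' n, Complex.log (1 + z * ((s n ^ p : ℝ) : ℂ))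

section LogDet

variable {s : ℕ → ℝ} {p c : ℝ}

theorem norm_mul_rpow (hs0 : ∀ n, 0 ≤ s n) (z : ℂ) (n : ℕ) :
    ‖z * ((s n ^ p : ℝ) : ℂ)‖ = ‖z‖ * s n ^ p := by
  rw [norm_mul, Complex.norm_real, Real.norm_of_nonneg (Real.rpow_nonneg (hs0 n) p)]

theorem norm_mul_rpow_lt (hs0 : ∀ n, 0 ≤ s n) (hsc : ∀ n, s n ≤ c) (hc : 1 ≤ c) (hp : 0 ≤ p)
    {z : ℂ} (hz : z ∈ Metric.ball (0 : ℂ) (1 / (2 * c ^ p))) (n : ℕ) :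
    ‖z * ((s n ^ p : ℝ) : ℂ)‖ < 1 / 2 := by
  have hcp : 0 < c ^ p := Real.rpow_pos_of_pos (by linarith) p
  rw [mem_ball_zero_iff, lt_div_iff₀ (by positivity)] at hz
  rw [norm_mul_rpow hs0]
  have := mul_le_mul_of_nonneg_left (Real.rpow_le_rpow (hs0 n) (hsc n) hp) (norm_nonneg z)
  linarith

theorem norm_log_one_add_le (hs0 : ∀ n, 0 ≤ s n) (hsc : ∀ n, s n ≤ c) (hc : 1 ≤ c) (hp : 0 ≤ p)
    {z : ℂ} (hz : z ∈ Metric.ball (0 : ℂ) (1 / (2 * c ^ p))) (n : ℕ) :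
    ‖Complex.log (1 + z * ((s n ^ p : ℝ) : ℂ))‖ ≤ 3 / 2 * (1 / (2 * c ^ p)) * s n ^ p := by
  refine (Complex.norm_log_one_add_half_le_self
    (norm_mul_rpow_lt hs0 hsc hc hp hz n).le).trans ?_
  rw [norm_mul_rpow hs0, mul_assoc]
  have := Real.rpow_nonneg (hs0 n) p
  have := (mem_ball_zero_iff.1 hz).le
  gcongr

theorem summable_log_one_add (hs0 : ∀ n, 0 ≤ s n) (hsc : ∀ n, s n ≤ c) (hc : 1 ≤ c) (hp : 0 ≤ p)
    (hs : Summable fun n => s n ^ p)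
    {z : ℂ} (hz : z ∈ Metric.ball (0 : ℂ) (1 / (2 * c ^ p))) :
    Summable fun n => Complex.log (1 + z * ((s n ^ p : ℝ) : ℂ)) :=
  (hs.mul_left _).of_norm_bounded (norm_log_one_add_le hs0 hsc hc hp hz)

theorem exp_logDet (hs0 : ∀ n, 0 ≤ s n) (hsc : ∀ n, s n ≤ c) (hc : 1 ≤ c) (hp : 0 ≤ p)
    (hs : Summable fun n => s n ^ p)
    {z : ℂ} (hz : z ∈ Metric.ball (0 : ℂ) (1 / (2 * c ^ p))) :
    Complex.exp (logDet s p z) = ∏' n, (1 + z * ((s n ^ p : ℝ) : ℂ)) := by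
  refine Complex.cexp_tsum_eq_tprod (fun n h => ?_) (summable_log_one_add hs0 hsc hc hp hs hz)
  have h1 := norm_mul_rpow_lt hs0 hsc hc hp hz n
  rw [← neg_eq_of_add_eq_zero_right h] at h1
  norm_num at h1

theorem differentiableOn_logDet (hs0 : ∀ n, 0 ≤ s n) (hsc : ∀ n, s n ≤ c) (hc : 1 ≤ c)
    (hp : 0 ≤ p) (hs : Summable fun n => s n ^ p) :
    DifferentiableOn ℂ (logDet s p) (Metric.ball 0 (1 / (2 * c ^ p))) := by
  refine Complex.differentiableOn_tsum_of_summable_norm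
    (hs.mul_left (3 / 2 * (1 / (2 * c ^ p)))) (fun n z hz => ?_) Metric.isOpen_ball
    fun n z hz => norm_log_one_add_le hs0 hsc hc hp hz n
  refine DifferentiableAt.differentiableWithinAt (DifferentiableAt.clog (by fun_prop) ?_)
  exact Complex.mem_slitPlane_of_norm_lt_one
    ((norm_mul_rpow_lt hs0 hsc hc hp hz n).trans (by norm_num))

/-- The logarithm of the determinant is the trace term up to an error of second order. -/
theorem norm_logDet_sub_le (hs0 : ∀ n, 0 ≤ s n) (hsc : ∀ n, s n ≤ c) (hc : 1 ≤ c)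
    (hp : 0 ≤ p) (hs : Summable fun n => s n ^ p) (hs2 : Summable fun n => s n ^ (2 * p))
    {z : ℂ} (hz : z ∈ Metric.ball (0 : ℂ) (1 / (2 * c ^ p))) :
    ‖logDet s p z - z * ((∑' n, s n ^ p : ℝ) : ℂ)‖ ≤ ‖z‖ ^ 2 * ∑' n, s n ^ (2 * p) := by
  have h1 : HasSum (fun n => z * ((s n ^ p : ℝ) : ℂ)) (z * ((∑' n, s n ^ p : ℝ) : ℂ)) :=
    (Complex.hasSum_ofReal.2 hs.hasSum).mul_left z
  have h2 := (summable_log_one_add hs0 hsc hc hp hs hz).hasSum.sub h1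
  rw [← tsum_mul_left, logDet, ← h2.tsum_eq]
  refine tsum_of_norm_bounded (hs2.mul_left _).hasSum fun n => ?_
  have h3 := norm_mul_rpow_lt hs0 hsc hc hp hz n
  refine (Complex.norm_log_one_add_sub_self_le (h3.trans (by norm_num))).trans ?_
  have h4 : (1 - ‖z * ((s n ^ p : ℝ) : ℂ)‖)⁻¹ ≤ 2 := by
    rw [inv_le_comm₀ (by linarith) two_pos]
    linarith
  have h5 : ‖z * ((s n ^ p : ℝ) : ℂ)‖ ^ 2 = ‖z‖ ^ 2 * s n ^ (2 * p) := by
    rw [norm_mul_rpow hs0, mul_pow, ← Real.rpow_mul_natCast (hs0 n), mul_comm p]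
    norm_cast
  rw [← h5]
  have h6 := mul_le_mul_of_nonneg_left h4 (sq_nonneg ‖z * ((s n ^ p : ℝ) : ℂ)‖)
  linarith

theorem ball_subset_ball_of_le_two (hc : 1 ≤ c) (hp : p ≤ 2) :
    Metric.ball (0 : ℂ) (1 / (2 * c ^ (2 : ℝ))) ⊆ Metric.ball 0 (1 / (2 * c ^ p)) := by
  have : 0 < c ^ p := Real.rpow_pos_of_pos (by linarith) p
  exact Metric.ball_subset_ball (by gcongr)

theorem tendsto_mul_logDet_sub (hs0 : ∀ n, 0 ≤ s n) (hsc : ∀ n, s n ≤ c) (hc : 1 ≤ c)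
    (hs : ∀ p : ℝ, 1 < p → Summable fun n => s n ^ p)
    {z : ℂ} (hz : z ∈ Metric.ball (0 : ℂ) (1 / (2 * c ^ (2 : ℝ)))) :
    Tendsto (fun p : ℝ => ((p - 1 : ℝ) : ℂ) * logDet s p z -
      z * (((p - 1) * ∑' n, s n ^ p : ℝ) : ℂ)) (𝓝[>] 1) (𝓝 0) := by
  have h1 : Tendsto (fun p : ℝ => (p - 1) * (‖z‖ ^ 2 * (c ^ (2 : ℝ) * ∑' n, s n ^ (2 : ℝ))))
      (𝓝[>] 1) (𝓝 0) := by
    have : Tendsto (fun p : ℝ => (p - 1) * (‖z‖ ^ 2 * (c ^ (2 : ℝ) * ∑' n, s n ^ (2 : ℝ))))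
        (𝓝 1) (𝓝 ((1 - 1) * (‖z‖ ^ 2 * (c ^ (2 : ℝ) * ∑' n, s n ^ (2 : ℝ))))) := by
      apply Continuous.tendsto
      fun_prop
    rw [sub_self, zero_mul] at this
    exact this.mono_left nhdsWithin_le_nhds
  refine squeeze_zero_norm' ?_ h1
  filter_upwards [Ioc_mem_nhdsGT (show (1 : ℝ) < 2 by norm_num)] with p hp
  have hp1 : 0 ≤ p - 1 := by linarith [hp.1]
  have h2 : ((p - 1 : ℝ) : ℂ) * logDet s p z - z * (((p - 1) * ∑' n, s n ^ p : ℝ) : ℂ) =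
      ((p - 1 : ℝ) : ℂ) * (logDet s p z - z * ((∑' n, s n ^ p : ℝ) : ℂ)) := by
    push_cast
    ring
  rw [h2, norm_mul, Complex.norm_real, Real.norm_of_nonneg hp1]
  have hs2 := hs (2 * p) (by linarith)
  refine mul_le_mul_of_nonneg_left ((norm_logDet_sub_le hs0 hsc hc (by linarith) (hs p hp.1) hs2
    (ball_subset_ball_of_le_two hc hp.2 hz)).trans ?_) hp1
  refine mul_le_mul_of_nonneg_left ?_ (sq_nonneg _)
  rw [← tsum_mul_left]
  refine hs2.tsum_le_tsum (fun n => ?_) ((hs 2 (by norm_num)).mul_left _)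
  have h3 : s n ^ (2 * p) = s n ^ (2 * p - 2) * s n ^ (2 : ℝ) := by
    rw [← Real.rpow_add_of_nonneg (hs0 n) (by linarith) (by norm_num)]
    congr 1
    ring
  rw [h3]
  refine mul_le_mul_of_nonneg_right ?_ (Real.rpow_nonneg (hs0 n) _)
  exact (Real.rpow_le_rpow (hs0 n) (hsc n) (by linarith)).trans
    (Real.rpow_le_rpow_of_exponent_le hc (by linarith [hp.2]))

end LogDet

/-! ### The regularised determinants -/

/-- A Dixmier functional extends the ordinary limit. -/
theorem DixmierFunctional.map_of_tendsto (ω : DixmierFunctional) (a : lp (fun _ : ℕ => ℝ) ∞)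
    {L : ℝ} (h : Tendsto (fun n => a n) atTop (𝓝 L)) : ω.toFun a = L := by
  have hmem : Memℓp (E := fun _ : ℕ => ℝ) (fun _ => (1 : ℝ)) ∞ :=
    memℓp_infty ⟨1, by rintro _ ⟨n, rfl⟩; simp⟩
  set e : lp (fun _ : ℕ => ℝ) ∞ := ⟨fun _ => 1, hmem⟩
  have h1 := ω.map_one e fun _ => rfl
  have h2 := ω.map_null (a - L • e) (by
    have h3 : (fun n => (a - L • e) n) = fun n => a n - L := by
      funext n
      change a n - L * 1 = a n - L
      rw [mul_one]
    rw [h3]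
    simpa using h.sub_const L)
  rw [map_sub, map_smul, h1, smul_eq_mul, mul_one] at h2
  linarith

variable {H : Type*} [NormedAddCommGroup H] [InnerProductSpace ℂ H] [CompleteSpace H]

theorem dixmierTrace_eq_of_tendsto (ω : DixmierFunctional) {T : H →L[ℂ] H} {L : ℝ}
    (h : Tendsto (logMean T) atTop (𝓝 L)) : dixmierTrace ω T = L := by
  have hb : Memℓp (E := fun _ : ℕ => ℝ) (logMean T) ∞ :=
    memℓp_infty h.norm.bddAbove_range
  rw [dixmierTrace, dif_pos hb]
  exact ω.map_of_tendsto _ h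

theorem tendsto_logMean_iff {T : H →L[ℂ] H} {L : ℝ} :
    Tendsto (logMean T) atTop (𝓝 L) ↔ Tendsto (fun N : ℕ =>
      (∑ n ∈ Finset.range N, singularValue T n) / Real.log N) atTop (𝓝 L) := by
  rw [← tendsto_add_atTop_iff_nat (f := fun N : ℕ =>
      (∑ n ∈ Finset.range N, singularValue T n) / Real.log N) 1]
  refine tendsto_congr fun k => ?_
  rw [logMean]
  push_cast
  rfl

section Det

variable {T : H →L[ℂ] H}

theorem singularValue_le (hT : T.IsPositive) (n : ℕ) :
    singularValue T n ≤ 1 + singularValue T 0 := by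
  linarith [singularValue_antitone hT n.zero_le]

theorem one_le_one_add_singularValue : 1 ≤ 1 + singularValue T 0 := by
  linarith [singularValue_nonneg T 0]

theorem summable_singularValue_rpow (hpos : T.IsPositive) (hT : MemDixmierIdeal T) {p : ℝ}
    (hp : 1 < p) : Summable fun n => singularValue T n ^ p :=
  summable_rpow_of_sum_isBigO_log (singularValue_antitone hpos) (singularValue_nonneg T) hT.2 hp

/-- In the disc where all factors are within `1 / 2` of `1`, the sum of the principal logarithms is
the continued logarithm. -/
theorem isLogAlong_detPow (hpos : T.IsPositive) (hT : MemDixmierIdeal T) {p : ℝ} (hp : 1 < p)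
    {z : ℂ} (hz : z ∈ Metric.ball (0 : ℂ) (1 / (2 * (1 + singularValue T 0) ^ p))) :
    IsLogAlong (detPow p T) z (logDet (singularValue T) p z) := by
  have hs := summable_singularValue_rpow hpos hT hp
  have hmem : ∀ t ∈ Set.Icc (0 : ℝ) 1,
      (t : ℂ) * z ∈ Metric.ball (0 : ℂ) (1 / (2 * (1 + singularValue T 0) ^ p)) := by
    intro t ht
    rw [mem_ball_zero_iff] at hz ⊢
    rw [norm_mul, Complex.norm_real, Real.norm_of_nonneg ht.1]
    exact (mul_le_of_le_one_left (norm_nonneg z) ht.2).trans_lt hz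
  refine ⟨fun t => logDet (singularValue T) p (t * z), ?_, ?_, ?_, fun t ht => ?_⟩
  · exact (differentiableOn_logDet (singularValue_nonneg T) (singularValue_le hpos)
      one_le_one_add_singularValue (by linarith) hs).continuousOn.comp
      (by fun_prop) hmem
  · simp [logDet]
  · simp
  · rw [exp_logDet (singularValue_nonneg T) (singularValue_le hpos)
      one_le_one_add_singularValue (by linarith) hs (hmem t ht),
      detPow_eq_tprod hpos hT.1 (by linarith) hs]

theorem regDetP_eq_exp (hpos : T.IsPositive) (hT : MemDixmierIdeal T) {p : ℝ} (hp : 1 < p)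
    {z : ℂ} (hz : z ∈ Metric.ball (0 : ℂ) (1 / (2 * (1 + singularValue T 0) ^ p))) :
    regDetP p T z = Complex.exp (((p - 1 : ℝ) : ℂ) * logDet (singularValue T) p z) :=
  powBranch_eq_of_isLogAlong (isLogAlong_detPow hpos hT hp hz)

theorem analyticOnNhd_regDetP (hpos : T.IsPositive) (hT : MemDixmierIdeal T) {p : ℝ} (hp : 1 < p) :
    AnalyticOnNhd ℂ (regDetP p T)
      (Metric.ball 0 (1 / (2 * (1 + singularValue T 0) ^ p))) := by
  refine DifferentiableOn.analyticOnNhd ?_ Metric.isOpen_ball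
  refine DifferentiableOn.congr ?_ fun z hz => regDetP_eq_exp hpos hT hp hz
  exact ((differentiableOn_logDet (singularValue_nonneg T) (singularValue_le hpos)
    one_le_one_add_singularValue (by linarith)
    (summable_singularValue_rpow hpos hT hp)).const_mul _).cexp

theorem tendsto_regDetP_mul_exp_neg (hpos : T.IsPositive) (hT : MemDixmierIdeal T) {z : ℂ}
    (hz : z ∈ Metric.ball (0 : ℂ) (1 / (2 * (1 + singularValue T 0) ^ (2 : ℝ)))) :
    Tendsto (fun p : ℝ => regDetP p T z *
      Complex.exp (-(z * (((p - 1) * ∑' n, singularValue T n ^ p : ℝ) : ℂ)))) (𝓝[>] 1) (𝓝 1) := by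
  have h1 := (Complex.continuous_exp.tendsto 0).comp (tendsto_mul_logDet_sub
    (singularValue_nonneg T) (singularValue_le hpos) one_le_one_add_singularValue
    (fun p hp => summable_singularValue_rpow hpos hT hp) hz)
  rw [Complex.exp_zero] at h1
  refine h1.congr' ?_
  filter_upwards [Ioc_mem_nhdsGT (show (1 : ℝ) < 2 by norm_num)] with p hp
  rw [regDetP_eq_exp hpos hT hp.1
    (ball_subset_ball_of_le_two one_le_one_add_singularValue hp.2 hz), ← Complex.exp_add,
    ← sub_eq_add_neg]
  rfl

theorem tendsto_regDetP_of_tendsto_logMean (hpos : T.IsPositive) (hT : MemDixmierIdeal T) {L : ℝ}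
    (hL : Tendsto (logMean T) atTop (𝓝 L)) {z : ℂ}
    (hz : z ∈ Metric.ball (0 : ℂ) (1 / (2 * (1 + singularValue T 0) ^ (2 : ℝ)))) :
    Tendsto (fun p : ℝ => regDetP p T z) (𝓝[>] 1) (𝓝 (Complex.exp (z * (L : ℂ)))) := by
  have h1 := tendsto_sub_mul_tsum_rpow_of_tendsto_sum_div_log (singularValue_antitone hpos)
    (singularValue_nonneg T) (fun p hp => summable_singularValue_rpow hpos hT hp)
    (tendsto_logMean_iff.1 hL)
  have h2 := (Complex.continuous_exp.tendsto _).comp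
    (((Complex.continuous_ofReal.tendsto L).comp h1).const_mul z)
  have h3 := (tendsto_regDetP_mul_exp_neg hpos hT hz).mul h2
  rw [one_mul] at h3
  refine h3.congr fun p => ?_
  simp only [Function.comp_apply]
  rw [mul_assoc, ← Complex.exp_add, neg_add_cancel, Complex.exp_zero, mul_one]

/-- Convergence of the determinants at a single small positive point already forces measurability:
at such a point `exp (t * x p) ≥ 1`, so its limit is nonzero and the logarithm can be taken. -/
theorem isDixmierMeasurable_of_tendsto_regDetP (hpos : T.IsPositive) (hT : MemDixmierIdeal T)
    {t : ℝ} (ht : 0 < t)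
    (htr : (t : ℂ) ∈ Metric.ball (0 : ℂ) (1 / (2 * (1 + singularValue T 0) ^ (2 : ℝ)))) {d : ℂ}
    (hd : Tendsto (fun p : ℝ => regDetP p T (t : ℂ)) (𝓝[>] 1) (𝓝 d)) :
    IsDixmierMeasurable T := by
  set x : ℝ → ℝ := fun p => (p - 1) * ∑' n, singularValue T n ^ p with hx
  have hx0 : ∀ p, 1 < p → 0 ≤ x p := fun p hp => mul_nonneg (by linarith)
    (tsum_nonneg fun n => Real.rpow_nonneg (singularValue_nonneg T n) p)
  have h1 : Tendsto (fun p => Real.exp (t * x p)) (𝓝[>] 1) (𝓝 d.re) := by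
    have h2 := hd.mul ((tendsto_regDetP_mul_exp_neg hpos hT htr).inv₀ one_ne_zero)
    rw [inv_one, mul_one] at h2
    have h3 := (Complex.continuous_re.tendsto d).comp h2
    refine h3.congr' ?_
    filter_upwards [Ioc_mem_nhdsGT (show (1 : ℝ) < 2 by norm_num)] with p hp
    have h4 : regDetP p T (t : ℂ) ≠ 0 := by
      rw [regDetP_eq_exp hpos hT hp.1
        (ball_subset_ball_of_le_two one_le_one_add_singularValue hp.2 htr)]
      exact Complex.exp_ne_zero _
    rw [Function.comp_apply, mul_inv, ← mul_assoc, mul_inv_cancel₀ h4, one_mul, ← Complex.exp_neg,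
      neg_neg, ← Complex.ofReal_mul, Complex.exp_ofReal_re]
  have h5 : 1 ≤ d.re := by
    refine ge_of_tendsto h1 ?_
    filter_upwards [self_mem_nhdsWithin] with p hp
    exact Real.one_le_exp (mul_nonneg ht.le (hx0 p hp))
  have h6 := (h1.log (by linarith)).const_mul t⁻¹
  have h7 : Tendsto x (𝓝[>] 1) (𝓝 (t⁻¹ * Real.log d.re)) := by
    refine h6.congr fun p => ?_
    rw [Real.log_exp, inv_mul_cancel_left₀ ht.ne']
  exact ⟨hT, _, tendsto_logMean_iff.2 (tendsto_sum_div_log_of_tendsto_sub_mul_tsum_rpow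
    (singularValue_antitone hpos) (singularValue_nonneg T)
    (fun p hp => summable_singularValue_rpow hpos hT hp) hT.2 h7)⟩

end Det

end DixmierDet

theorem lemma2p9 {H : Type*} [NormedAddCommGroup H] [InnerProductSpace ℂ H] [CompleteSpace H]
    (T : H →L[ℂ] H) (hpos : T.IsPositive) (hcompact : IsCompactOperator T)
    (hT : DixmierDet.MemDixmierIdeal T)
    (htrace : ∀ p : ℝ, 1 < p → DixmierDet.IsTraceClass (T ^ p))
    (ω : DixmierDet.DixmierFunctional) :
    (∀ p : ℝ, 1 < p → ∃ r > 0,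
      (∀ z ∈ Metric.ball (0 : ℂ) r, ∃ w, DixmierDet.IsLogAlong (DixmierDet.detPow p T) z w) ∧
      AnalyticOnNhd ℂ (DixmierDet.regDetP p T) (Metric.ball 0 r)) ∧
    ((∃ r > 0, ∀ z ∈ Metric.ball (0 : ℂ) r, ∃ d : ℂ,
        Tendsto (fun p : ℝ => DixmierDet.regDetP p T z) (𝓝[>] 1) (𝓝 d)) ↔
      DixmierDet.IsDixmierMeasurable T) ∧
    (DixmierDet.IsDixmierMeasurable T →
      (∃ r > 0, ∀ z ∈ Metric.ball (0 : ℂ) r,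
        Tendsto (fun p : ℝ => DixmierDet.regDetP p T z) (𝓝[>] 1)
          (𝓝 (Complex.exp (z * (DixmierDet.dixmierTrace ω T : ℂ))))) ∧
      HasDerivAt (DixmierDet.regDetLim T) (DixmierDet.dixmierTrace ω T : ℂ) 0 ∧
      ∀ d : ℂ, DixmierDet.IsRegDet T d ↔
        d = Complex.exp (DixmierDet.dixmierTrace ω T : ℂ)) := by
  have hc : 0 < 1 + DixmierDet.singularValue T 0 :=
    one_pos.trans_le DixmierDet.one_le_one_add_singularValue
  have hr : ∀ p : ℝ, 0 < 1 / (2 * (1 + DixmierDet.singularValue T 0) ^ p) := fun p => by positivity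
  refine ⟨fun p hp => ⟨_, hr p, fun z hz => ⟨_, DixmierDet.isLogAlong_detPow hpos hT hp hz⟩,
    DixmierDet.analyticOnNhd_regDetP hpos hT hp⟩, ⟨?_, ?_⟩, ?_⟩
  · rintro ⟨r, hr0, h⟩
    have ht : 0 < min r (1 / (2 * (1 + DixmierDet.singularValue T 0) ^ (2 : ℝ))) / 2 :=
      half_pos (lt_min hr0 (hr 2))
    set t := min r (1 / (2 * (1 + DixmierDet.singularValue T 0) ^ (2 : ℝ))) / 2
    have htr : ∀ ρ, min r (1 / (2 * (1 + DixmierDet.singularValue T 0) ^ (2 : ℝ))) ≤ ρ →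
        (t : ℂ) ∈ Metric.ball (0 : ℂ) ρ := fun ρ hρ => by
      rw [mem_ball_zero_iff, Complex.norm_real, Real.norm_of_nonneg ht.le]
      exact (half_lt_self (lt_min hr0 (hr 2))).trans_le hρ
    obtain ⟨d, hd⟩ := h t (htr r (min_le_left _ _))
    exact DixmierDet.isDixmierMeasurable_of_tendsto_regDetP hpos hT ht
      (htr _ (min_le_right _ _)) hd
  · rintro ⟨-, L, hL⟩
    exact ⟨_, hr 2, fun z hz =>
      ⟨_, DixmierDet.tendsto_regDetP_of_tendsto_logMean hpos hT hL hz⟩⟩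
  · rintro ⟨-, L, hL⟩
    rw [DixmierDet.dixmierTrace_eq_of_tendsto ω hL]
    have hlim : ∀ z ∈ Metric.ball (0 : ℂ) (1 / (2 * (1 + DixmierDet.singularValue T 0) ^ (2 : ℝ))),
        Tendsto (fun p : ℝ => DixmierDet.regDetP p T z) (𝓝[>] 1)
          (𝓝 (Complex.exp (z * (L : ℂ)))) := fun z hz =>
      DixmierDet.tendsto_regDetP_of_tendsto_logMean hpos hT hL hz
    have heq : DixmierDet.regDetLim T =ᶠ[𝓝 0] fun z => Complex.exp (z * (L : ℂ)) := by
      filter_upwards [Metric.ball_mem_nhds (0 : ℂ) (hr 2)] with z hz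
      exact (hlim z hz).limUnder_eq
    have hentire : Differentiable ℂ fun z : ℂ => Complex.exp (z * (L : ℂ)) := by fun_prop
    refine ⟨⟨_, hr 2, hlim⟩, ?_, fun d => ⟨?_, ?_⟩⟩
    · have h1 : HasDerivAt (fun z : ℂ => Complex.exp (z * (L : ℂ))) (L : ℂ) 0 := by
        simpa using ((hasDerivAt_id (0 : ℂ)).mul_const (L : ℂ)).cexp
      exact h1.congr_of_eventuallyEq heq
    · rintro ⟨D, hD, hDeq, rfl⟩
      have h1 := (hD.differentiableOn.analyticOnNhd isOpen_univ).eq_of_eventuallyEq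
        (hentire.differentiableOn.analyticOnNhd isOpen_univ) (hDeq.trans heq)
      simp only [h1, one_mul]
    · rintro rfl
      exact ⟨_, hentire, heq.symm, by rw [one_mul]⟩
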